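/- Let $H(\omega_1)$ be the collection of all sets whose transitive closure is countable, let $\lhd$ be a fixed well-ordering of $H(\omega_1)$, and let $\mathcal S$ be the collection of all countable elementary substructures $N$ of $\langle H(\omega_1),\in,\lhd\rangle$. For $N\in\mathcal S$ put $\delta_N=N\cap\omega_1$. Let $\alpha$ be an additively indecomposable ordinal with $1<\alpha<\omega_1$. The forcing notion $\mathbb P[\alpha]$ consists of all triples $p=\langle\mathcal M_p,f_p,\mathcal W_p\rangle$ such that 1. $\mathcal M_p=\langle M^p_\xi:\xi\le\gamma_p\rangle$, for some $\gamma_p<\alpha$, is an $\in$-increasing sequence of elements of $\mathcal S$ which is continuous at limits; 2. $f_p$ is a function with domain $\mathcal M_p$ such that $f_p(M^p_\xi)$ is a finite subset of $M^p_{\xi+1}$ for $\xi<\gamma_p$, and $f_p(M^p_{\gamma_p})$ is a finite subset of $H(\omega_1)$; 3. $\mathcal W_p\subseteq\mathcal M_p$, and $\langle\mathcal M_p\cap N,\ f_p{\restriction}(\mathcal M_p\cap N),\ \mathcal W_p\cap N\rangle\in N$ for every $N\in\mathcal W_p$. The order is: $q\le p$ if and only if $\mathcal M_p\subseteq\mathcal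 M_q$, $f_p(M)\subseteq f_q(M)$ for every $M\in\mathcal M_p$, and $\mathcal W_p\subseteq\mathcal W_q$. Let $\mathbb P$ be the forcing notion of all pairs $p=\langle\mathcal M_p,f_p\rangle$ such that $\mathcal M_p=\langle M^p_i:i<n_p\rangle$ is a finite $\in$-increasing sequence of elements of $\mathcal S$ and $f_p$ is a function with domain $\mathcal M_p$ such that $f_p(M^p_i)$ is a finite subset of $M^p_{i+1}$ if $i+1<n_p$, and a finite subset of $H(\omega_1)$ if $i+1=n_p$; the order is $q\le p$ if and only if $\mathcal M_p\subseteq\mathcal M_q$ and $f_p(M)\subseteq f_q(M)$ for every $M\in\mathcal M_p$. **Lemma.** If $G\subseteq\mathbb P[\alpha]$ is a generic filter over the ground model $V$, then in $V[G]$ the set $C=\{\delta_M: M\in\mathcal M_p\text{ for some }p\in G\}$ is a club (closed unbounded subset) in the ordinal $\omega_1=\omega_1^V$. The same holds for $\mathbb P$ in place of $\mathbb P[\alpha]$. In other words, for both forcing notions, every condition forces that $\dot C$, the canonical name for $C$, is a club in $\check\omega_1$. -/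

import Mathlib

open Ordinal
open FirstOrder FirstOrder.Language

universe u v

namespace ClubForcing

noncomputable section

/-! ### Forcing: names, the forcing relation, and the formula "`C` is a club in `κ`" -/

/-- The relation symbols of the language of set theory: one binary symbol `∈`. -/
inductive MemRel : ℕ → Type
  | mem : MemRel 2

/-- The first-order language `{∈}` of set theory. -/
def memLang : Language := ⟨fun _ => Empty, MemRel⟩

/-- The atomic formula `t₁ ∈ t₂`. -/
def memF {n : ℕ} (t₁ t₂ : memLang.Term (Empty ⊕ Fin n)) : memLang.BoundedFormula Empty n :=
  Relations.boundedFormula₂ (L := memLang) (MemRel.mem : memLang.Relations 2) t₁ t₂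

/-- The first-order formula "`C` is a closed unbounded subset of the ordinal `κ`" with free
variables `C = &0` and `κ = &1`: `C ⊆ κ`; for every `x ∈ κ` there is `y ∈ C` with `x ∈ y`;
every nonempty `γ ∈ κ` in which `C` is unbounded (for all `x ∈ γ` there is `y ∈ C ∩ γ` with
`x ∈ y`) is a member of `C`. -/
def clubFormula : memLang.BoundedFormula Empty 2 :=
  (∀' (memF (&2) (&0) ⟹ memF (&2) (&1))) ⊓
  (∀' (memF (&2) (&1) ⟹ ∃' (memF (&3) (&0) ⊓ memF (&2) (&3)))) ⊓
  (∀' (memF (&2) (&1) ⟹ ((∃' memF (&3) (&2)) ⟹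
    ((∀' (memF (&3) (&2) ⟹ ∃' (memF (&4) (&0) ⊓ (memF (&4) (&2) ⊓ memF (&3) (&4))))) ⟹
      memF (&2) (&0)))))

/-- `P`-names. The name `mk ι σ A` is the set of pairs `{(σ i, p) | i : ι, p ∈ A i}`. -/
inductive Name (P : Type v) : Type (max (u + 1) v)
  | mk (ι : Type u) (σ : ι → Name P) (A : ι → Set P) : Name P

namespace Name

variable {P : Type v}

/-- The interpretation of a name by `G`: the set of the interpretations of all `σ i` such that
`(σ i, p)` belongs to the name for some `p ∈ G`. -/
def val (G : Set P) : Name.{u, v} P → ZFSet.{u}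
  | mk ι σ A => ZFSet.range fun i : {i : ι // ∃ p ∈ G, p ∈ A i} => val G (σ i.1)

/-- The canonical name `x̌ = {(y̌, p) | y ∈ x, p ∈ P}` of a ground model set `x`. -/
def check (P : Type v) (x : ZFSet.{u}) : Name.{u, v} P :=
  mk (Shrink.{u} x) (fun i => check P ((equivShrink x).symm i).1) (fun _ => Set.univ)
termination_by x
decreasing_by exact ((equivShrink x).symm i).2

variable [Preorder P]

/-- `ForcesEq σ τ p` is `p ⊩ σ = τ`: whenever `q ≤ p` is below some `r` with `(σ i, r) ∈ σ`, then
`q ⊩ σ i ∈ τ`, that is, densely many `s ≤ q` are below some `t` with `(τ j, t) ∈ τ` and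
`s ⊩ σ i = τ j`; and symmetrically. -/
def ForcesEq : Name.{u, v} P → Name.{u, v} P → P → Prop
  | mk _ σ A, mk _ τ B, p =>
    (∀ i, ∀ q ≤ p, (∃ r ∈ A i, q ≤ r) →
      ∀ q' ≤ q, ∃ s ≤ q', ∃ j, (∃ t ∈ B j, s ≤ t) ∧ ForcesEq (σ i) (τ j) s) ∧
    (∀ j, ∀ q ≤ p, (∃ r ∈ B j, q ≤ r) →
      ∀ q' ≤ q, ∃ s ≤ q', ∃ i, (∃ t ∈ A i, s ≤ t) ∧ ForcesEq (σ i) (τ j) s)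

/-- `ForcesMem σ τ p` is `p ⊩ σ ∈ τ`: densely many `q ≤ p` are below some `t` with
`(τ j, t) ∈ τ` and force `σ = τ j`. -/
def ForcesMem (σ : Name.{u, v} P) : Name.{u, v} P → P → Prop
  | mk _ τ B, p => ∀ q ≤ p, ∃ s ≤ q, ∃ j, (∃ t ∈ B j, s ≤ t) ∧ ForcesEq σ (τ j) s

end Name

section Forces

variable {P : Type v} [Preorder P]

/-- The name denoted by a term (a variable) under an assignment. -/
def termName {n : ℕ} (a : Fin n → Name.{u, v} P) : memLang.Term (Empty ⊕ Fin n) → Name.{u, v} P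
  | .var (Sum.inl e) => e.elim
  | .var (Sum.inr i) => a i
  | .func f _ => Empty.elim f

/-- The forcing relation `p ⊩ φ(a₀, …, aₙ₋₁)` for formulas `φ` of the language of set theory,
built from `⊥`, `=`, `∈`, `→`, `∀`, and names `aᵢ`. -/
def Forces : {n : ℕ} → memLang.BoundedFormula Empty n → (Fin n → Name.{u, v} P) → P → Prop
  | _, .falsum, _, _ => False
  | _, .equal t₁ t₂, a, p => Name.ForcesEq (termName a t₁) (termName a t₂) p
  | _, .rel MemRel.mem ts, a, p => Name.ForcesMem (termName a (ts 0)) (termName a (ts 1)) p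
  | _, .imp φ ψ, a, p => ∀ q ≤ p, Forces φ a q → Forces ψ a q
  | _, .all φ, a, p => ∀ τ : Name.{u, v} P, Forces φ (Fin.snoc a τ) p

end Forces

/-! ### Countable elementary submodels of `H(ω₁)` -/

/-- `x ∈ H(ω₁)`: the transitive closure of `x` is countable, i.e. `x` is included in some countable
transitive set. -/
def IsHC (x : ZFSet.{u}) : Prop :=
  ∃ t : ZFSet.{u}, t.IsTransitive ∧ x ⊆ t ∧ {y | y ∈ t}.Countable

/-- The collection `H(ω₁)` of hereditarily countable sets. -/
def HC : Type (u + 1) := {x : ZFSet.{u} // IsHC x}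

/-- The symbols of the language `{∈, ◁}`. -/
inductive ModelRel : ℕ → Type
  | mem : ModelRel 2
  | lt : ModelRel 2

/-- The first-order language `{∈, ◁}`. -/
def modelLang : Language := ⟨fun _ => Empty, ModelRel⟩

/-- The structure `⟨H(ω₁), ∈, ◁⟩`, for a binary relation `◁` on `H(ω₁)`. -/
@[reducible] def hcStructure (lt : HC.{u} → HC.{u} → Prop) : modelLang.Structure HC.{u} where
  funMap f := Empty.elim f
  RelMap r x :=
    match r with
    | .mem => (x 0).1 ∈ (x 1).1
    | .lt => lt (x 0) (x 1)

/-- `N ∈ 𝒮`: the set `N` is (the universe of) a countable elementary substructure of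
`⟨H(ω₁), ∈, ◁⟩`. -/
def IsModel (lt : HC.{u} → HC.{u} → Prop) (N : ZFSet.{u}) : Prop :=
  {x | x ∈ N}.Countable ∧
    letI := hcStructure lt
    ∃ S : modelLang.ElementarySubstructure HC.{u},
      ∀ x : ZFSet.{u}, x ∈ N ↔ ∃ h : IsHC x, (⟨x, h⟩ : HC.{u}) ∈ S

/-- The (von Neumann) ordinal `ω₁` as a set. -/
def omegaOne : ZFSet.{u} := (ω_ 1 : Ordinal.{u}).toZFSet

/-- `δ_N = N ∩ ω₁`. -/
def delta (N : ZFSet.{u}) : ZFSet.{u} := N ∩ omegaOne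

/-- The canonical name `{(x̌, p) | p ∈ P, x = δ_N for some N ∈ 𝓜_p}` of
`{δ_N | N ∈ 𝓜_p for some p ∈ G}`; each `δ_N` is a subset of `ω₁`. -/
def clubName {P : Type v} (models : P → ZFSet.{u}) : Name.{u, v} P :=
  .mk (Shrink.{u} omegaOne.{u}.powerset)
    (fun i => Name.check P ((equivShrink omegaOne.{u}.powerset).symm i).1)
    (fun i => {p | ∃ N ∈ models p, delta N = ((equivShrink omegaOne.{u}.powerset).symm i).1})

theorem val_check {P : Type v} {G : Set P} (hG : G.Nonempty) (x : ZFSet.{u}) :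
    (Name.check P x).val G = x := by
  induction x using ZFSet.inductionOn with
  | _ x ih =>
    obtain ⟨p, hp⟩ := hG
    rw [Name.check, Name.val]
    ext z
    rw [ZFSet.mem_range]
    constructor
    · rintro ⟨i, rfl⟩
      rw [ih _ ((equivShrink x).symm i.1).2]
      exact ((equivShrink x).symm i.1).2
    · intro hz
      refine ⟨⟨equivShrink x ⟨z, hz⟩, p, hp, trivial⟩, ?_⟩
      simp [ih z hz]

/-- The interpretation of `clubName` by a (nonempty) set `G` of conditions is
`{δ_N | N ∈ 𝓜_p for some p ∈ G}`. -/
theorem mem_val_clubName {P : Type v} {G : Set P} (models : P → ZFSet.{u}) (x : ZFSet.{u}) :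
    x ∈ (clubName models).val G ↔ ∃ p ∈ G, ∃ N ∈ models p, x = delta N := by
  rw [clubName, Name.val, ZFSet.mem_range]
  constructor
  · rintro ⟨⟨i, p, hp, N, hN, h⟩, rfl⟩
    exact ⟨p, hp, N, hN, by simp only [val_check ⟨p, hp⟩, h]⟩
  · rintro ⟨p, hp, N, hN, rfl⟩
    have h : delta N ∈ omegaOne.powerset := by
      rw [ZFSet.mem_powerset]
      intro y hy
      exact (ZFSet.mem_inter.1 hy).2
    refine ⟨⟨equivShrink _ ⟨delta N, h⟩, p, hp, N, hN, by simp⟩, ?_⟩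
    simp [val_check ⟨p, hp⟩]

/-- `f` (a set of ordered pairs) is a function with domain `M`. -/
def IsFunOn (f M : ZFSet.{u}) : Prop :=
  (∀ z ∈ f, ∃ N ∈ M, ∃ a, z = ZFSet.pair N a) ∧ ∀ N ∈ M, ∃! a, ZFSet.pair N a ∈ f

/-- `f_p(N) ⊆ f_q(N)` for every `N ∈ M`, where `f_p` and `f_q` are functions defined on `M`. -/
def FunLE (M f g : ZFSet.{u}) : Prop :=
  ∀ N ∈ M, ∀ a b, ZFSet.pair N a ∈ f → ZFSet.pair N b ∈ g → a ⊆ b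

/-! ### The forcing with finite conditions -/

/-- Conditions `p = ⟨𝓜_p, f_p⟩` of the forcing `ℙ`: `𝓜_p = ⟨s i : i < n⟩` is a finite
`∈`-increasing sequence of elements of `𝒮` (as it is `∈`-increasing, it is coded by the set
`models` of its members), `f_p` is a function on `𝓜_p`, `f_p(s i)` is a finite subset of
`s (i + 1)` if `i + 1 < n`, and is a finite subset of `H(ω₁)` if `i + 1 = n`. -/
structure FinCond (lt : HC.{u} → HC.{u} → Prop) : Type (u + 1) where
  models : ZFSet.{u}
  f : ZFSet.{u}
  isFunOn : IsFunOn f models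
  chain : ∃ (n : ℕ) (s : ℕ → ZFSet.{u}),
    (∀ i < n, IsModel lt (s i)) ∧
    (∀ i j, i < j → j < n → s i ∈ s j) ∧
    (∀ N, N ∈ models ↔ ∃ i < n, N = s i) ∧
    (∀ i, i + 1 < n → ∀ a, ZFSet.pair (s i) a ∈ f → {x | x ∈ a}.Finite ∧ a ⊆ s (i + 1)) ∧
    (∀ i, i + 1 = n → ∀ a, ZFSet.pair (s i) a ∈ f → {x | x ∈ a}.Finite ∧ ∀ x ∈ a, IsHC x)

/-- `q ≤ p` iff `𝓜_p ⊆ 𝓜_q` and `f_p(N) ⊆ f_q(N)` for all `N ∈ 𝓜_p`. -/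
instance (lt : HC.{u} → HC.{u} → Prop) : Preorder (FinCond lt) where
  le q p := p.models ⊆ q.models ∧ FunLE p.models p.f q.f
  le_refl p := ⟨fun _ h => h, fun N hN a b ha hb => by
    rw [(p.isFunOn.2 N hN).unique ha hb]⟩
  le_trans r q p hrq hqp := ⟨fun _ h => hrq.1 (hqp.1 h), fun N hN a c ha hc => by
    obtain ⟨b, hb, -⟩ := q.isFunOn.2 N (hqp.1 hN)
    exact fun _ h => hrq.2 N (hqp.1 hN) b c hb hc (hqp.2 N hN a b ha hb h)⟩

/-! ### The forcing `ℙ[α]` -/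

/-- The set coding `p↾N = ⟨𝓜_p ∩ N, f_p ↾ (𝓜_p ∩ N), 𝓦_p ∩ N⟩`. -/
def restrictCode (M f W N : ZFSet.{u}) : ZFSet.{u} :=
  ZFSet.pair (M ∩ N)
    (ZFSet.pair (f.sep fun z => ∃ K ∈ M ∩ N, ∃ a, z = ZFSet.pair K a) (W ∩ N))

/-- Conditions `p = ⟨𝓜_p, f_p, 𝓦_p⟩` of the forcing `ℙ[α]`: `𝓜_p = ⟨s ξ : ξ ≤ γ⟩`, `γ < α`, is an
`∈`-increasing sequence of elements of `𝒮`, continuous at limits (coded by the set `models` of its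
members), `f_p` is a function on `𝓜_p`, `f_p(s ξ)` is a finite subset of `s (ξ + 1)` for `ξ < γ`,
`f_p(s γ)` is a finite subset of `H(ω₁)`, and `𝓦_p ⊆ 𝓜_p` satisfies `p↾N ∈ N` for all
`N ∈ 𝓦_p`. -/
structure Cond (lt : HC.{u} → HC.{u} → Prop) (α : Ordinal.{u}) : Type (u + 1) where
  models : ZFSet.{u}
  f : ZFSet.{u}
  W : ZFSet.{u}
  isFunOn : IsFunOn f models
  chain : ∃ γ < α, ∃ s : Ordinal.{u} → ZFSet.{u},
    (∀ ξ ≤ γ, IsModel lt (s ξ)) ∧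
    (∀ ξ η, ξ < η → η ≤ γ → s ξ ∈ s η) ∧
    (∀ η ≤ γ, Order.IsSuccLimit η → ∀ x, x ∈ s η ↔ ∃ ξ < η, x ∈ s ξ) ∧
    (∀ N, N ∈ models ↔ ∃ ξ ≤ γ, N = s ξ) ∧
    (∀ ξ < γ, ∀ a, ZFSet.pair (s ξ) a ∈ f → {x | x ∈ a}.Finite ∧ a ⊆ s (ξ + 1)) ∧
    (∀ a, ZFSet.pair (s γ) a ∈ f → {x | x ∈ a}.Finite ∧ ∀ x ∈ a, IsHC x)
  W_subset : W ⊆ models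
  restrict_mem : ∀ N ∈ W, restrictCode models f W N ∈ N

/-- `q ≤ p` iff `𝓜_p ⊆ 𝓜_q`, `f_p(N) ⊆ f_q(N)` for all `N ∈ 𝓜_p`, and `𝓦_p ⊆ 𝓦_q`. -/
instance (lt : HC.{u} → HC.{u} → Prop) (α : Ordinal.{u}) : Preorder (Cond lt α) where
  le q p := p.models ⊆ q.models ∧ FunLE p.models p.f q.f ∧ p.W ⊆ q.W
  le_refl p := ⟨fun _ h => h, fun N hN a b ha hb => by
    rw [(p.isFunOn.2 N hN).unique ha hb], fun _ h => h⟩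
  le_trans r q p hrq hqp := ⟨fun _ h => hrq.1 (hqp.1 h), fun N hN a c ha hc => by
    obtain ⟨b, hb, -⟩ := q.isFunOn.2 N (hqp.1 hN)
    exact fun _ h => hrq.2.1 N (hqp.1 hN) b c hb hc (hqp.2.1 N hN a b ha hb h),
    fun _ h => hrq.2.2 (hqp.2.2 h)⟩

end

end ClubForcing

/-! Both forcings are handled by one density argument. Every `delta N` is a countable ordinal
because a countable elementary submodel of `H(ω₁)` is transitive: it contains an enumeration of each
of its elements, hence all the enumerated values. So along an `∈`-increasing chain the models also
increase under inclusion.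

Unboundedness: by Löwenheim–Skolem a further model containing a given `β < ω₁`, the last model and
the last value of `f` can be put on top of any condition. In `ℙ[α]` there is room for it because `α`
is closed under successors (`exists_append`).

Closedness: suppose `β` is decided, some but not all models of the condition lie below `β`, and no
`δ_N` equals `β`. By continuity the first model containing `β` is a successor `s (ξ + 1)`, and `δ_{s
ξ} < β` (`exists_gap`). Adding `β` to the finite set `f (s ξ)` is a promise that the next model
after `s ξ`, in every stronger condition, contains `β`. Hence no later condition has a model `N`
with `δ_{s ξ} < δ_N < β`, and `C ∩ β` is bounded below `β` (`notMem_delta_of_delta_mem`). The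
promise preserves the requirement on `𝓦`: if `N ∈ 𝓦` contains `s ξ`, then `N` includes `s (ξ + 1)`,
so `β ∈ N`, and `p↾N` is altered by one pair that lies in `N` (`restrictCode_updateValue_mem`).

The criterion `forces_club` turns these density facts into a statement about the forcing relation.
Finite chains are chains indexed by an ordinal below `ω`, where continuity is vacuous, so the same
lemmas serve `ℙ`. -/

namespace ClubForcing

/-! ### Forced equality and membership; check names -/

namespace Name

variable {P : Type v} [Preorder P]

theorem ForcesEq.mono {σ τ : Name.{u, v} P} {p q : P} (h : ForcesEq σ τ p) (hq : q ≤ p) :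
    ForcesEq σ τ q := by
  cases σ; cases τ
  rw [ForcesEq] at h ⊢
  exact ⟨fun i r hr => h.1 i r (hr.trans hq), fun i r hr => h.2 i r (hr.trans hq)⟩

theorem ForcesMem.mono {σ τ : Name.{u, v} P} {p q : P} (h : ForcesMem σ τ p) (hq : q ≤ p) :
    ForcesMem σ τ q := by
  cases τ
  exact fun r hr => h r (hr.trans hq)

theorem ForcesEq.refl (σ : Name.{u, v} P) (p : P) : ForcesEq σ σ p := by
  induction σ generalizing p with
  | mk ι σ A ih =>
    rw [ForcesEq]
    refine ⟨?_, ?_⟩ <;>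
    · rintro i q - ⟨r, hr, hqr⟩ q' hq'
      exact ⟨q', le_rfl, i, ⟨r, hr, hq'.trans hqr⟩, ih i q'⟩

theorem ForcesEq.symm {σ τ : Name.{u, v} P} {p : P} (h : ForcesEq σ τ p) : ForcesEq τ σ p := by
  induction σ generalizing τ p with
  | mk ι σ A ih =>
    cases τ
    rw [ForcesEq] at h ⊢
    refine ⟨fun j q hq hj q' hq' => ?_, fun i q hq hi q' hq' => ?_⟩
    · obtain ⟨s, hs, i, hi, h⟩ := h.2 j q hq hj q' hq'
      exact ⟨s, hs, i, hi, ih i h⟩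
    · obtain ⟨s, hs, j, hj, h⟩ := h.1 i q hq hi q' hq'
      exact ⟨s, hs, j, hj, ih i h⟩

theorem ForcesEq.trans {σ τ ρ : Name.{u, v} P} {p : P} (h : ForcesEq σ τ p)
    (h' : ForcesEq τ ρ p) : ForcesEq σ ρ p := by
  induction σ generalizing τ ρ p with
  | mk ι σ A ih =>
    cases τ; cases ρ
    rw [ForcesEq] at h h' ⊢
    refine ⟨fun i q hq hi q' hq' => ?_, fun k q hq hk q' hq' => ?_⟩
    · obtain ⟨s, hs, j, hj, e⟩ := h.1 i q hq hi q' hq'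
      obtain ⟨t, ht, k, hk, e'⟩ := h'.1 j s (hs.trans (hq'.trans hq)) hj s le_rfl
      exact ⟨t, ht.trans hs, k, hk, ih i (e.mono ht) e'⟩
    · obtain ⟨s, hs, j, hj, e⟩ := h'.2 k q hq hk q' hq'
      obtain ⟨t, ht, i, hi, e'⟩ := h.2 j s (hs.trans (hq'.trans hq)) hj s le_rfl
      exact ⟨t, ht.trans hs, i, hi, ih i e' (e.mono ht)⟩

theorem ForcesMem.congr_left {σ σ' τ : Name.{u, v} P} {p : P} (h : ForcesMem σ τ p)
    (e : ForcesEq σ σ' p) : ForcesMem σ' τ p := by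
  cases τ
  intro q hq
  obtain ⟨s, hs, j, hj, h⟩ := h q hq
  exact ⟨s, hs, j, hj, (e.mono (hs.trans hq)).symm.trans h⟩

theorem ForcesMem.congr_right {σ τ τ' : Name.{u, v} P} {p : P} (h : ForcesMem σ τ p)
    (e : ForcesEq τ τ' p) : ForcesMem σ τ' p := by
  cases τ; cases τ'
  intro q hq
  obtain ⟨s, hs, j, hj, h⟩ := h q hq
  rw [ForcesEq] at e
  obtain ⟨t, ht, k, hk, e⟩ := e.1 j s (hs.trans hq) hj s le_rfl
  exact ⟨t, ht.trans hs, k, hk, (h.mono ht).trans e⟩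

theorem ForcesMem.of_dense {σ τ : Name.{u, v} P} {p : P}
    (h : ∀ q ≤ p, ∃ r ≤ q, ForcesMem σ τ r) : ForcesMem σ τ p := by
  cases τ
  intro q hq
  obtain ⟨r, hr, h⟩ := h q hq
  obtain ⟨s, hs, h⟩ := h r le_rfl
  exact ⟨s, hs.trans hr, h⟩

theorem forcesMem_check_iff {σ : Name.{u, v} P} {x : ZFSet.{u}} {p : P} :
    ForcesMem σ (check P x) p ↔ ∀ q ≤ p, ∃ s ≤ q, ∃ y ∈ x, ForcesEq σ (check P y) s := by
  rw [check, ForcesMem]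
  refine forall₂_congr fun q _ => exists_congr fun s => and_congr_right fun _ => ⟨?_, ?_⟩
  · rintro ⟨j, -, h⟩
    exact ⟨_, ((equivShrink x).symm j).2, h⟩
  · rintro ⟨y, hy, h⟩
    refine ⟨equivShrink x ⟨y, hy⟩, ⟨s, trivial, le_rfl⟩, ?_⟩
    simpa using h

theorem forcesMem_check_of_mem {x y : ZFSet.{u}} (h : y ∈ x) (p : P) :
    ForcesMem (check P y) (check P x) p :=
  forcesMem_check_iff.2 fun q _ => ⟨q, le_rfl, y, h, ForcesEq.refl _ _⟩

theorem ForcesEq.forcesMem_of_mem {x : ZFSet.{u}} {τ : Name.{u, v} P} {p : P}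
    (h : ForcesEq τ (check P x) p) {y : ZFSet.{u}} (hy : y ∈ x) : ForcesMem (check P y) τ p :=
  (forcesMem_check_of_mem hy p).congr_right h.symm

/-- By `∈`-induction: an element of one side is forced into the other, so some stronger condition
equates it with a definite element there, and the induction hypothesis makes the two equal. -/
theorem ForcesEq.check_inj {x y : ZFSet.{u}} {p : P}
    (h : ForcesEq (check P x) (check P y) p) : x = y := by
  induction x using ZFSet.inductionOn generalizing y p with
  | _ x ih =>
    ext z
    constructor
    · intro hz
      obtain ⟨s, -, w, hw, e⟩ := forcesMem_check_iff.1 (h.symm.forcesMem_of_mem hz) p le_rfl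
      rwa [ih z hz e]
    · intro hz
      obtain ⟨s, -, w, hw, e⟩ := forcesMem_check_iff.1 (h.forcesMem_of_mem hz) p le_rfl
      rwa [← ih w hw e.symm]

theorem mem_of_forcesMem_check {x y : ZFSet.{u}} {p : P}
    (h : ForcesMem (check P y) (check P x) p) : y ∈ x := by
  obtain ⟨s, -, w, hw, e⟩ := forcesMem_check_iff.1 h p le_rfl
  rwa [e.check_inj]

end Name

/-! ### A density criterion for forcing a club -/

section Club

open Name

variable {P : Type v} [Preorder P]

theorem forcesMem_clubName_iff {models : P → ZFSet.{u}}
    (hanti : ∀ p q, q ≤ p → models p ⊆ models q) {σ : Name.{u, v} P} {p : P} :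
    ForcesMem σ (clubName models) p ↔
      ∀ q ≤ p, ∃ s ≤ q, ∃ N ∈ models s, ForcesEq σ (check P (delta N)) s := by
  rw [clubName, ForcesMem]
  refine forall₂_congr fun q _ => exists_congr fun s => and_congr_right fun _ => ⟨?_, ?_⟩
  · rintro ⟨j, ⟨t, ⟨N, hN, h⟩, hst⟩, e⟩
    exact ⟨N, hanti _ _ hst hN, h ▸ e⟩
  · rintro ⟨N, hN, e⟩
    have h : delta N ∈ omegaOne.powerset :=
      ZFSet.mem_powerset.2 fun y hy => (ZFSet.mem_inter.1 hy).2
    exact ⟨equivShrink _ ⟨delta N, h⟩, ⟨s, ⟨N, hN, by simp⟩, le_rfl⟩, by simpa using e⟩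

/-- The quantifier `∃'` abbreviates `¬∀¬`, so forcing it only yields witnesses on a dense set. The
same happens for `⊓` below. -/
theorem forces_ex_iff {n : ℕ} {φ : memLang.BoundedFormula Empty (n + 1)}
    {a : Fin n → Name.{u, v} P} {p : P} :
    Forces (∃' φ) a p ↔ ∀ q ≤ p, ∃ τ, ∃ r ≤ q, Forces φ (Fin.snoc a τ) r := by
  change (∀ q ≤ p, (∀ τ, ∀ r ≤ q, Forces φ (Fin.snoc a τ) r → False) → False) ↔ _
  simp

theorem forces_inf_iff {n : ℕ} {φ ψ : memLang.BoundedFormula Empty n}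
    {a : Fin n → Name.{u, v} P} {p : P} :
    Forces (φ ⊓ ψ) a p ↔ ∀ q ≤ p, ∃ r ≤ q, Forces φ a r ∧ ∃ s ≤ r, Forces ψ a s := by
  change (∀ q ≤ p, (∀ r ≤ q, Forces φ a r → ∀ s ≤ r, Forces ψ a s → False) → False) ↔ _
  simp

theorem forces_imp_iff {n : ℕ} {φ ψ : memLang.BoundedFormula Empty n}
    {a : Fin n → Name.{u, v} P} {p : P} :
    Forces (φ ⟹ ψ) a p ↔ ∀ q ≤ p, Forces φ a q → Forces ψ a q := Iff.rfl

theorem forces_all_iff {n : ℕ} {φ : memLang.BoundedFormula Empty (n + 1)}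
    {a : Fin n → Name.{u, v} P} {p : P} :
    Forces (∀' φ) a p ↔ ∀ τ, Forces φ (Fin.snoc a τ) p := Iff.rfl

theorem forces_memF_iff {n : ℕ} {i j : Fin n} {a : Fin n → Name.{u, v} P} {p : P} :
    Forces (memF (&i) (&j)) a p ↔ ForcesMem (a i) (a j) p := Iff.rfl

theorem forces_clubFormula {C κ : Name.{u, v} P} {p : P}
    (hsub : ∀ τ q, q ≤ p → ForcesMem τ C q → ForcesMem τ κ q)
    (hunb : ∀ τ q, q ≤ p → ForcesMem τ κ q →
      ∃ σ, ∃ r ≤ q, ForcesMem σ C r ∧ ForcesMem τ σ r)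
    (hclosed : ∀ τ q, q ≤ p → ForcesMem τ κ q → (∀ r ≤ q, ∃ σ, ∃ s ≤ r, ForcesMem σ τ s) →
      (∀ σ r, r ≤ q → ForcesMem σ τ r →
        ∃ ρ, ∃ s ≤ r, ForcesMem ρ C s ∧ ForcesMem ρ τ s ∧ ForcesMem σ ρ s) →
      ForcesMem τ C q) :
    Forces clubFormula ![C, κ] p := by
  rw [clubFormula]
  simp only [forces_ex_iff, forces_inf_iff, forces_imp_iff, forces_all_iff, forces_memF_iff]
  intro q hq
  refine ⟨q, le_rfl, fun r hr => ⟨r, le_rfl, fun τ s hs => hsub τ s (hs.trans (hr.trans hq)),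
    r, le_rfl, fun τ s hs hτ t ht => ?_⟩, q, le_rfl, fun τ r hr hτ s hs hne t ht hlim => ?_⟩
  · obtain ⟨σ, w, hw, h₁, h₂⟩ :=
      hunb τ t (ht.trans (hs.trans (hr.trans hq))) (ForcesMem.mono hτ ht)
    exact ⟨σ, w, hw, fun x hx => ⟨x, le_rfl, ForcesMem.mono h₁ hx, x, le_rfl,
      ForcesMem.mono h₂ hx⟩⟩
  · refine hclosed τ t (ht.trans (hs.trans (hr.trans hq))) (ForcesMem.mono hτ (ht.trans hs))
      (fun w hw => hne w (hw.trans ht)) fun σ w hw hσ => ?_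
    obtain ⟨ρ, x, hx, h⟩ := hlim σ w hw hσ w le_rfl
    obtain ⟨y, hy, h₁, z, hz, h⟩ := h x le_rfl
    obtain ⟨z', hz', h₂, w', hw', h₃⟩ := h z le_rfl
    exact ⟨ρ, w', hw'.trans (hz'.trans (hz.trans (hy.trans hx))),
      ForcesMem.mono h₁ (hw'.trans (hz'.trans hz)), ForcesMem.mono h₂ hw', h₃⟩

/-- Isolates the combinatorics needed from a forcing. If a decided `β` were a limit of `C` outside
`C`, then `hgap` would give an extension forcing `C ∩ β` to be bounded by some `x ∈ β`. Its two
existence hypotheses are met because `C ∩ β` is nonempty and `C` is unbounded in `ω₁`. -/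
theorem forces_club {models : P → ZFSet.{u}} (hanti : ∀ p q, q ≤ p → models p ⊆ models q)
    (hdelta : ∀ p, ∀ N ∈ models p, delta N ∈ omegaOne)
    (hunb : ∀ p, ∀ β ∈ omegaOne, ∃ q ≤ p, ∃ N ∈ models q, β ∈ delta N)
    (hgap : ∀ p, ∀ β ∈ omegaOne, (∃ N ∈ models p, delta N ∈ β) → (∃ N ∈ models p, β ∈ delta N) →
      (∀ N ∈ models p, delta N ≠ β) →
      ∃ q ≤ p, ∃ x ∈ β, ∀ r ≤ q, ∀ N ∈ models r, delta N ∈ β → x ∉ delta N) (p : P) :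
    Forces clubFormula ![clubName models, check P omegaOne.{u}] p := by
  refine forces_clubFormula (fun τ q _ h => ?_) (fun τ q _ h => ?_) fun τ q _ h hne hlim => ?_
  · rw [forcesMem_clubName_iff hanti] at h
    rw [forcesMem_check_iff]
    intro r hr
    obtain ⟨s, hs, N, hN, e⟩ := h r hr
    exact ⟨s, hs, _, hdelta s N hN, e⟩
  · obtain ⟨s, hs, β, hβ, e⟩ := forcesMem_check_iff.1 h q le_rfl
    obtain ⟨r, hr, N, hN, hβN⟩ := hunb s β hβ
    refine ⟨check P (delta N), r, hr.trans hs, ?_,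
      (forcesMem_check_of_mem hβN r).congr_left (e.mono hr).symm⟩
    exact (forcesMem_clubName_iff hanti).2 fun t ht =>
      ⟨t, le_rfl, N, hanti _ _ ht hN, ForcesEq.refl _ _⟩
  · refine ForcesMem.of_dense fun q' hq' => ?_
    -- `s` decides the value `β` of `τ`; either some extension of `s` puts `β` into `C`, or none
    -- does, which is refuted.
    obtain ⟨s, hs, β, hβ, e⟩ := forcesMem_check_iff.1 h q' hq'
    by_cases hex : ∃ t ≤ s, ∃ N ∈ models t, delta N = β
    · obtain ⟨t, ht, N, hN, rfl⟩ := hex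
      exact ⟨t, ht.trans hs, (forcesMem_clubName_iff hanti).2 fun w hw =>
        ⟨w, le_rfl, N, hanti _ _ hw hN, e.mono (hw.trans ht)⟩⟩
    · exfalso
      push Not at hex
      have key : ∀ σ, ∀ t ≤ s, ForcesMem σ τ t →
          ∃ w ≤ t, ∃ N ∈ models w, delta N ∈ β ∧ ForcesMem σ (check P (delta N)) w := by
        intro σ t ht hσ
        obtain ⟨ρ, t', ht', h₁, h₂, h₃⟩ := hlim σ t (ht.trans (hs.trans hq')) hσ
        obtain ⟨w, hw, N, hN, e'⟩ := (forcesMem_clubName_iff hanti).1 h₁ t' le_rfl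
        refine ⟨w, hw.trans ht', N, hN, ?_, (h₃.mono hw).congr_right e'⟩
        exact mem_of_forcesMem_check (((h₂.mono hw).congr_left e').congr_right
          (e.mono (hw.trans (ht'.trans ht))))
      obtain ⟨σ, t, ht, hσ⟩ := hne s (hs.trans hq')
      obtain ⟨w, hw, N₁, hN₁, hβ₁, -⟩ := key σ t ht hσ
      obtain ⟨w', hw', N₂, hN₂, hβ₂⟩ := hunb w β hβ
      have hws : w' ≤ s := hw'.trans (hw.trans ht)
      obtain ⟨r, hr, x, hx, hrx⟩ := hgap w' β hβ ⟨N₁, hanti _ _ hw' hN₁, hβ₁⟩ ⟨N₂, hN₂, hβ₂⟩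
        (hex w' hws)
      -- Unboundedness of `C` in `β`, applied to the bound `x` itself, produces the forbidden model.
      obtain ⟨z, hz, N, hN, hNβ, hxN⟩ := key (check P x) r (hr.trans hws)
        ((e.mono (hr.trans hws)).forcesMem_of_mem hx)
      exact hrx z hz N hN hNβ (mem_of_forcesMem_check hxN)

end Club

/-! ### Hereditarily countable sets and countable ordinals -/

section HereditarilyCountable

theorem HC.ext_iff {x y : HC.{u}} : x = y ↔ x.1 = y.1 := Subtype.ext_iff

theorem IsHC.mem {x y : ZFSet.{u}} (hx : IsHC x) (hy : y ∈ x) : IsHC y := by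
  obtain ⟨t, ht, hxt, hc⟩ := hx
  exact ⟨t, ht, ht.subset_of_mem (hxt hy), hc⟩

theorem IsHC.countable {x : ZFSet.{u}} (hx : IsHC x) : {y | y ∈ x}.Countable := by
  obtain ⟨t, -, hxt, hc⟩ := hx
  exact hc.mono fun y hy => hxt hy

/-- Together with `x`, the union of countable transitive sets covering the elements of `x` is again
countable and transitive. -/
theorem isHC_of_forall_mem {x : ZFSet.{u}} (hc : {y | y ∈ x}.Countable)
    (h : ∀ y ∈ x, IsHC y) : IsHC x := by
  choose! t ht hyt htc using h
  let T : ZFSet.{u} := ZFSet.iUnion fun y : Shrink.{u} x => t ((equivShrink x).symm y).1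
  have hT : ∀ z, z ∈ T ↔ ∃ y ∈ x, z ∈ t y := by
    intro z
    rw [ZFSet.mem_iUnion]
    constructor
    · rintro ⟨y, hy⟩
      exact ⟨_, ((equivShrink x).symm y).2, hy⟩
    · rintro ⟨y, hy, hz⟩
      exact ⟨equivShrink x ⟨y, hy⟩, by simpa using hz⟩
  refine ⟨x ∪ T, fun y hy z hz => ?_, fun y hy => ZFSet.mem_union.2 (Or.inl hy), ?_⟩
  · rw [ZFSet.mem_union, hT] at hy ⊢
    rcases hy with hy | ⟨w, hw, hyw⟩
    · exact Or.inr ⟨y, hy, hyt y hy hz⟩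
    · exact Or.inr ⟨w, hw, (ht w hw).subset_of_mem hyw hz⟩
  · have : {y | y ∈ x ∪ T} = {y | y ∈ x} ∪ ⋃ y ∈ {y | y ∈ x}, {z | z ∈ t y} := by
      ext z
      simp [hT]
    rw [this]
    exact hc.union (hc.biUnion fun y hy => htc y hy)

theorem isHC_empty : IsHC (∅ : ZFSet.{u}) :=
  isHC_of_forall_mem (by simp) (by simp)

theorem isHC_insert {x y : ZFSet.{u}} (hx : IsHC x) (hy : IsHC y) : IsHC (insert x y) := by
  refine isHC_of_forall_mem ?_ ?_
  · simpa [Set.ofPred_or] using hy.countable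
  · simp only [ZFSet.mem_insert_iff, forall_eq_or_imp]
    exact ⟨hx, fun z hz => hy.mem hz⟩

theorem isHC_singleton {x : ZFSet.{u}} (hx : IsHC x) : IsHC ({x} : ZFSet.{u}) := by
  refine isHC_of_forall_mem ?_ ?_ <;> simp [hx]

theorem isHC_upair {x y : ZFSet.{u}} (hx : IsHC x) (hy : IsHC y) : IsHC ({x, y} : ZFSet.{u}) :=
  isHC_insert hx (isHC_singleton hy)

theorem isHC_pair {x y : ZFSet.{u}} (hx : IsHC x) (hy : IsHC y) : IsHC (ZFSet.pair x y) :=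
  isHC_upair (isHC_singleton hx) (isHC_upair hx hy)

theorem IsHC.of_subset {x y : ZFSet.{u}} (hx : IsHC x) (hyx : y ⊆ x) : IsHC y := by
  obtain ⟨t, ht, hxt, hc⟩ := hx
  exact ⟨t, ht, fun z hz => hxt (hyx hz), hc⟩

theorem isHC_of_mem_omegaOne {β : ZFSet.{u}} (h : β ∈ omegaOne) : IsHC β := by
  obtain ⟨a, ha, rfl⟩ := Ordinal.mem_toZFSet_iff.1 h
  refine ⟨a.toZFSet, (ZFSet.isOrdinal_toZFSet a).isTransitive, fun _ h => h, ?_⟩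
  have h₁ : Cardinal.lift.{u + 1} a.card ≤ Cardinal.aleph0 := by
    rw [Cardinal.lift_le_aleph0, ← Cardinal.lt_aleph_one_iff, ← Cardinal.lt_ord,
      Cardinal.ord_aleph]
    exact ha
  change Set.Countable (a.toZFSet : Set ZFSet.{u})
  rw [← Cardinal.le_aleph0_iff_set_countable]
  rw [← Ordinal.card_toZFSet, ← ZFSet.cardinalMk_coe_sort] at h₁
  exact h₁

theorem omegaOne_not_countable : ¬ {y | y ∈ omegaOne.{u}}.Countable := by
  intro h
  have h₁ : Cardinal.mk (omegaOne.{u}) ≤ Cardinal.aleph0 := Cardinal.le_aleph0_iff_set_countable.2 h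
  rw [ZFSet.cardinalMk_coe_sort, Cardinal.lift_le_aleph0, omegaOne, Ordinal.card_toZFSet,
    Ordinal.card_omega] at h₁
  exact (Cardinal.aleph0_lt_aleph_one).not_ge h₁

theorem isOrdinal_of_mem_omegaOne {β : ZFSet.{u}} (h : β ∈ omegaOne) : β.IsOrdinal :=
  (ZFSet.isOrdinal_toZFSet _).mem h

end HereditarilyCountable

/-! ### Relations definable in `⟨H(ω₁), ∈, ◁⟩` -/

section Definability

/-- The relation `R` on `H(ω₁)` is definable in `⟨H(ω₁), ∈, ◁⟩` by a formula without parameters. -/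
def IsDefinable (lt : HC.{u} → HC.{u} → Prop) {n : ℕ} (R : (Fin n → HC.{u}) → Prop) : Prop :=
  letI := hcStructure lt
  ∃ φ : modelLang.BoundedFormula Empty n, ∀ v : Fin n → HC.{u}, φ.Realize default v ↔ R v

namespace IsDefinable

variable {lt : HC.{u} → HC.{u} → Prop} {n : ℕ} {R S : (Fin n → HC.{u}) → Prop}

theorem mem (i j : Fin n) : IsDefinable lt fun v => (v i).1 ∈ (v j).1 := by
  let := hcStructure lt
  exact ⟨Relations.boundedFormula₂ (L := modelLang) (ModelRel.mem : modelLang.Relations 2)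
    (&i) (&j), fun v => Iff.rfl⟩

theorem eq (i j : Fin n) : IsDefinable lt fun v => (v i).1 = (v j).1 := by
  let := hcStructure lt
  exact ⟨Term.bdEqual (&i) (&j), fun v => HC.ext_iff⟩

theorem imp (hR : IsDefinable lt R) (hS : IsDefinable lt S) :
    IsDefinable lt fun v => R v → S v := by
  obtain ⟨φ, hφ⟩ := hR
  obtain ⟨ψ, hψ⟩ := hS
  let := hcStructure lt
  exact ⟨φ.imp ψ, fun v => by rw [BoundedFormula.realize_imp, hφ, hψ]⟩

theorem not (hR : IsDefinable lt R) : IsDefinable lt fun v => ¬ R v := by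
  obtain ⟨φ, hφ⟩ := hR
  let := hcStructure lt
  exact ⟨∼φ, fun v => by rw [BoundedFormula.realize_not, hφ]⟩

theorem and (hR : IsDefinable lt R) (hS : IsDefinable lt S) :
    IsDefinable lt fun v => R v ∧ S v := by
  obtain ⟨φ, hφ⟩ := hR
  obtain ⟨ψ, hψ⟩ := hS
  let := hcStructure lt
  exact ⟨φ ⊓ ψ, fun v => by rw [BoundedFormula.realize_inf, hφ, hψ]⟩

theorem or (hR : IsDefinable lt R) (hS : IsDefinable lt S) :
    IsDefinable lt fun v => R v ∨ S v := by
  obtain ⟨φ, hφ⟩ := hR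
  obtain ⟨ψ, hψ⟩ := hS
  let := hcStructure lt
  exact ⟨φ ⊔ ψ, fun v => by rw [BoundedFormula.realize_sup, hφ, hψ]⟩

theorem iff (hR : IsDefinable lt R) (hS : IsDefinable lt S) :
    IsDefinable lt fun v => (R v ↔ S v) := by
  obtain ⟨φ, hφ⟩ := hR
  obtain ⟨ψ, hψ⟩ := hS
  let := hcStructure lt
  exact ⟨φ.iff ψ, fun v => by rw [BoundedFormula.realize_iff, hφ, hψ]⟩

theorem all {R : (Fin n → HC.{u}) → HC.{u} → Prop}
    (hR : IsDefinable lt fun v : Fin (n + 1) → HC.{u} => R (Fin.init v) (v (Fin.last n))) :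
    IsDefinable lt fun v => ∀ x, R v x := by
  obtain ⟨φ, hφ⟩ := hR
  let := hcStructure lt
  exact ⟨∀' φ, fun v => by simp only [BoundedFormula.realize_all, hφ, Fin.init_snoc, Fin.snoc_last]⟩

theorem ex {R : (Fin n → HC.{u}) → HC.{u} → Prop}
    (hR : IsDefinable lt fun v : Fin (n + 1) → HC.{u} => R (Fin.init v) (v (Fin.last n))) :
    IsDefinable lt fun v => ∃ x, R v x := by
  obtain ⟨φ, hφ⟩ := hR
  let := hcStructure lt
  exact ⟨∃' φ, fun v => by simp only [BoundedFormula.realize_ex, hφ, Fin.init_snoc, Fin.snoc_last]⟩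

theorem congr (hR : IsDefinable lt R) (h : ∀ v, S v ↔ R v) : IsDefinable lt S := by
  obtain rfl : S = R := funext fun v => propext (h v)
  exact hR

theorem upair (i j k : Fin n) : IsDefinable lt fun v => (v k).1 = {(v i).1, (v j).1} := by
  have : IsDefinable lt fun v : Fin n → HC.{u} =>
      ∀ w : HC.{u}, w.1 ∈ (v k).1 ↔ w.1 = (v i).1 ∨ w.1 = (v j).1 :=
    all (iff (mem _ _) (or (eq _ _) (eq _ _)))
  refine this.congr fun v => ⟨fun h w => by rw [h, ZFSet.mem_pair], fun h => ?_⟩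
  ext z
  rw [ZFSet.mem_pair]
  constructor
  · intro hz
    exact (h ⟨z, (v k).2.mem hz⟩).1 hz
  · rintro (rfl | rfl)
    · exact (h (v i)).2 (Or.inl rfl)
    · exact (h (v j)).2 (Or.inr rfl)

theorem pair (i j k : Fin n) :
    IsDefinable lt fun v => (v k).1 = ZFSet.pair (v i).1 (v j).1 := by
  have : IsDefinable lt fun v : Fin n → HC.{u} => ∃ a b : HC.{u},
      a.1 = {(v i).1, (v i).1} ∧ b.1 = {(v i).1, (v j).1} ∧ (v k).1 = {a.1, b.1} :=
    ex (ex (and (upair _ _ _) (and (upair _ _ _) (upair _ _ _))))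
  refine this.congr fun v => ⟨fun h => ?_, ?_⟩
  · refine ⟨⟨_, isHC_upair (v i).2 (v i).2⟩, ⟨_, isHC_upair (v i).2 (v j).2⟩, rfl, rfl, ?_⟩
    exact h.trans (by simp only [ZFSet.pair_eq_singleton, ZFSet.pair])
  · rintro ⟨a, b, ha, hb, h⟩
    rw [h, ha, hb, ZFSet.pair_eq_singleton, ZFSet.pair]

end IsDefinable

/-- The Zermelo numeral `{…{∅}…}`. -/
def numeral : ℕ → ZFSet.{u}
  | 0 => ∅
  | n + 1 => {numeral n}

theorem numeral_injective : Function.Injective numeral.{u} := by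
  intro m
  induction m with
  | zero =>
    rintro (_ | n) h
    · rfl
    · have : numeral n ∈ (∅ : ZFSet.{u}) := by
        rw [show (∅ : ZFSet.{u}) = numeral (n + 1) from h, numeral]
        exact ZFSet.mem_singleton.2 rfl
      exact absurd this (ZFSet.notMem_empty _)
  | succ m ih =>
    rintro (_ | n) h
    · have : numeral m ∈ (∅ : ZFSet.{u}) := by
        rw [show (∅ : ZFSet.{u}) = numeral (m + 1) from h.symm, numeral]
        exact ZFSet.mem_singleton.2 rfl
      exact absurd this (ZFSet.notMem_empty _)
    · rw [ih (ZFSet.singleton_inj.1 h)]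

theorem isHC_numeral (n : ℕ) : IsHC (numeral.{u} n) := by
  induction n with
  | zero => exact isHC_empty
  | succ n ih => exact isHC_singleton ih

theorem isHC_range {e : ℕ → ZFSet.{u}} (h : ∀ n, IsHC (e n)) : IsHC (ZFSet.range e) := by
  refine isHC_of_forall_mem ?_ ?_
  · simpa using! Set.countable_range e
  · simpa using h

/-- `x` belongs to every set in `H(ω₁)` which contains `∅` and is closed under `m ↦ {m}`. -/
def IsNumeral (x : HC.{u}) : Prop :=
  ∀ w : HC.{u}, (∀ e : HC.{u}, (∀ z : HC.{u}, z.1 ∉ e.1) → e.1 ∈ w.1) →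
    (∀ m k : HC.{u}, m.1 ∈ w.1 → k.1 = {m.1, m.1} → k.1 ∈ w.1) → x.1 ∈ w.1

/-- The set of all numerals is itself in `H(ω₁)`, so it is one of the sets `w` over which
`IsNumeral` quantifies. -/
theorem IsNumeral.exists_eq {x : HC.{u}} (h : IsNumeral x) : ∃ n, x.1 = numeral n := by
  have := h ⟨ZFSet.range numeral.{u}, isHC_range isHC_numeral⟩ ?_ ?_
  · obtain ⟨n, hn⟩ := ZFSet.mem_range.1 this
    exact ⟨n, hn.symm⟩
  · intro e he
    refine ZFSet.mem_range.2 ⟨0, ?_⟩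
    rw [numeral, eq_comm, ZFSet.eq_empty]
    exact fun y hy => he ⟨y, e.2.mem hy⟩ hy
  · intro m k hm hk
    obtain ⟨n, hn⟩ := ZFSet.mem_range.1 hm
    exact ZFSet.mem_range.2 ⟨n + 1, by rw [numeral, hn, hk, ZFSet.pair_eq_singleton]⟩

theorem isNumeral_numeral (n : ℕ) : IsNumeral ⟨numeral.{u} n, isHC_numeral n⟩ := by
  intro w h₀ h₁
  induction n with
  | zero => exact h₀ ⟨∅, isHC_empty⟩ fun z => ZFSet.notMem_empty _
  | succ n ih =>
    exact h₁ ⟨_, isHC_numeral n⟩ ⟨_, isHC_numeral (n + 1)⟩ ih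
      (ZFSet.pair_eq_singleton _).symm

theorem IsDefinable.isNumeral {lt : HC.{u} → HC.{u} → Prop} {n : ℕ} (i : Fin n) :
    IsDefinable lt fun v => IsNumeral (v i) :=
  all (imp (all (imp (all (not (mem _ _))) (mem _ _)))
    (imp (all (all (imp (mem _ _) (imp (upair _ _ _) (mem _ _))))) (mem _ _)))

end Definability

/-! ### Closure properties of elementary submodels -/

namespace IsModel

variable {lt : HC.{u} → HC.{u} → Prop} {N : ZFSet.{u}}

theorem isHC_of_mem (hN : IsModel lt N) {x : ZFSet.{u}} (hx : x ∈ N) : IsHC x := by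
  obtain ⟨-, S, hS⟩ := hN
  exact ((hS x).1 hx).1

theorem isHC (hN : IsModel lt N) : IsHC N :=
  isHC_of_forall_mem hN.1 fun _ hx => hN.isHC_of_mem hx

/-- One direction of the Tarski–Vaught test, and the only way elementarity is used: `∃' φ` passes
down to the submodel, and its witness there passes back up. -/
theorem exists_mem {n : ℕ} (hN : IsModel lt N) {R : (Fin (n + 1) → HC.{u}) → Prop}
    (hR : IsDefinable lt R) (v : Fin n → HC.{u}) (hv : ∀ i, (v i).1 ∈ N)
    (h : ∃ a, R (Fin.snoc v a)) : ∃ a : HC.{u}, a.1 ∈ N ∧ R (Fin.snoc v a) := by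
  obtain ⟨-, S, hS⟩ := hN
  obtain ⟨φ, hφ⟩ := hR
  let := hcStructure lt
  let w : Fin n → S := fun i => ⟨v i, ((hS _).1 (hv i)).2⟩
  have key := S.subtype.map_boundedFormula (∃' φ) default w
  have e : ∀ b : S, S.subtype ∘ (Fin.snoc w b : Fin (n + 1) → S) = Fin.snoc v b.1 := by
    intro b
    rw [Fin.comp_snoc]
    rfl
  have h₁ : (∃' φ).Realize (M := HC.{u}) (S.subtype ∘ default) (S.subtype ∘ w) := by
    rw [BoundedFormula.realize_ex]
    obtain ⟨a, ha⟩ := h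
    refine ⟨a, ?_⟩
    rw [← hφ] at ha
    convert! ha
  rw [key, BoundedFormula.realize_ex] at h₁
  obtain ⟨b, hb⟩ := h₁
  rw [← S.subtype.map_boundedFormula, e b] at hb
  refine ⟨b.1, (hS _).2 ⟨b.1.2, b.2⟩, (hφ _).1 ?_⟩
  convert! hb

theorem upair_mem (hN : IsModel lt N) {x y : ZFSet.{u}} (hx : x ∈ N) (hy : y ∈ N) :
    ({x, y} : ZFSet.{u}) ∈ N := by
  have hx' := hN.isHC_of_mem hx
  have hy' := hN.isHC_of_mem hy
  obtain ⟨a, ha, h⟩ := hN.exists_mem (IsDefinable.upair 0 1 2) ![⟨x, hx'⟩, ⟨y, hy'⟩]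
    (by simp [Fin.forall_fin_two, hx, hy]) ⟨⟨_, isHC_upair hx' hy'⟩, rfl⟩
  replace h : a.1 = {x, y} := h
  rwa [← h]

theorem singleton_mem (hN : IsModel lt N) {x : ZFSet.{u}} (hx : x ∈ N) :
    ({x} : ZFSet.{u}) ∈ N := by
  rw [← ZFSet.pair_eq_singleton]
  exact hN.upair_mem hx hx

theorem pair_mem (hN : IsModel lt N) {x y : ZFSet.{u}} (hx : x ∈ N) (hy : y ∈ N) :
    ZFSet.pair x y ∈ N :=
  hN.upair_mem (hN.singleton_mem hx) (hN.upair_mem hx hy)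

theorem empty_mem (hN : IsModel lt N) : ∅ ∈ N := by
  obtain ⟨a, ha, h⟩ := hN.exists_mem (n := 0)
    (R := fun v => ∀ z : HC.{u}, z.1 ∉ (v 0).1) (.all (.not (.mem _ _))) ![] (fun i => i.elim0)
    ⟨⟨∅, isHC_empty⟩, fun z => ZFSet.notMem_empty _⟩
  replace h : ∀ z : HC.{u}, z.1 ∉ a.1 := h
  rwa [← (ZFSet.eq_empty a.1).2 fun y hy => h ⟨y, a.2.mem hy⟩ hy]

theorem numeral_mem (hN : IsModel lt N) (n : ℕ) : numeral n ∈ N := by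
  induction n with
  | zero => exact hN.empty_mem
  | succ n ih => exact hN.singleton_mem ih

/-- `f` is a function and every element of `x` is its value at some numeral. -/
def Enumerates (f x : HC.{u}) : Prop :=
  (∀ n y y' p p' : HC.{u}, p.1 = ZFSet.pair n.1 y.1 → p.1 ∈ f.1 → p'.1 = ZFSet.pair n.1 y'.1 →
    p'.1 ∈ f.1 → y.1 = y'.1) ∧
  ∀ y : HC.{u}, y.1 ∈ x.1 → ∃ n p : HC.{u}, IsNumeral n ∧ p.1 = ZFSet.pair n.1 y.1 ∧ p.1 ∈ f.1

theorem isDefinable_enumerates {n : ℕ} (i j : Fin n) :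
    IsDefinable lt fun v => Enumerates (v i) (v j) :=
  .and (.all (.all (.all (.all (.all (.imp (.pair _ _ _) (.imp (.mem _ _)
    (.imp (.pair _ _ _) (.imp (.mem _ _) (.eq _ _)))))))))) <|
  .all (.imp (.mem _ _) (.ex (.ex (.and (.isNumeral _) (.and (.pair _ _ _) (.mem _ _))))))

theorem exists_enumerates (x : HC.{u}) : ∃ f, Enumerates f x := by
  rcases Set.eq_empty_or_nonempty {y | y ∈ x.1} with h | h
  · refine ⟨⟨∅, isHC_empty⟩, fun n y y' p p' _ hp => absurd hp (ZFSet.notMem_empty _), fun y hy => ?_⟩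
    exact absurd hy (Set.eq_empty_iff_forall_notMem.1 h _)
  · obtain ⟨e, he⟩ := x.2.countable.exists_eq_range h
    have he' : ∀ y, y ∈ x.1 ↔ ∃ n, e n = y := fun y => Set.ext_iff.1 he y
    have hc : ∀ n, IsHC (e n) := fun n => x.2.mem ((he' _).2 ⟨n, rfl⟩)
    refine ⟨⟨ZFSet.range fun n => ZFSet.pair (numeral n) (e n),
      isHC_range fun n => isHC_pair (isHC_numeral n) (hc n)⟩, ?_, ?_⟩
    · rintro n y y' p p' h₁ h₂ h₃ h₄
      obtain ⟨k, hk⟩ := ZFSet.mem_range.1 h₂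
      obtain ⟨l, hl⟩ := ZFSet.mem_range.1 h₄
      rw [h₁, ZFSet.pair_inj] at hk
      rw [h₃, ZFSet.pair_inj] at hl
      obtain rfl := numeral_injective (hk.1.trans hl.1.symm)
      exact hk.2.symm.trans hl.2
    · intro y hy
      obtain ⟨n, hn⟩ := (he' _).1 hy
      exact ⟨⟨_, isHC_numeral n⟩, ⟨_, isHC_pair (isHC_numeral n) y.2⟩, isNumeral_numeral n, rfl,
        ZFSet.mem_range.2 ⟨n, by rw [hn]⟩⟩

/-- By elementarity `N` contains some `f` enumerating `x`. All numerals are in `N`, and each `y ∈ x`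
is the unique value of `f` at one of them, hence belongs to `N`. -/
theorem isTransitive (hN : IsModel lt N) : N.IsTransitive := by
  intro x hx y hy
  have hx' := hN.isHC_of_mem hx
  obtain ⟨f, hf, h⟩ := hN.exists_mem (isDefinable_enumerates 1 0) ![⟨x, hx'⟩]
    (by simpa using hx) (exists_enumerates ⟨x, hx'⟩)
  replace h : Enumerates f ⟨x, hx'⟩ := h
  obtain ⟨n, p, hn, hp, hpf⟩ := h.2 ⟨y, hx'.mem hy⟩ hy
  obtain ⟨k, hk⟩ := hn.exists_eq
  obtain ⟨z, hz, p', hp', hpf'⟩ := hN.exists_mem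
    (R := fun v : Fin 3 → HC.{u} => ∃ p : HC.{u}, p.1 = ZFSet.pair (v 1).1 (v 2).1 ∧ p.1 ∈ (v 0).1)
    (.ex (.and (.pair _ _ _) (.mem _ _))) ![f, n]
    (by simp [Fin.forall_fin_two, hf, hk, hN.numeral_mem]) ⟨⟨y, hx'.mem hy⟩, p, hp, hpf⟩
  have : y = z.1 := h.1 n _ z p p' hp hpf hp' hpf'
  rwa [this]

/-- The operation that replaces one pair of a function by another; this is what keeps modified
restrictions `p↾N` inside `N`. -/
theorem insert_diff_singleton_mem (hN : IsModel lt N) {x y z : ZFSet.{u}} (hx : x ∈ N)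
    (hy : y ∈ N) (hz : z ∈ N) : insert x (y \ {z}) ∈ N := by
  have hx' := hN.isHC_of_mem hx
  have hy' := hN.isHC_of_mem hy
  have hz' := hN.isHC_of_mem hz
  have hc : IsHC (insert x (y \ {z})) :=
    isHC_insert hx' (hy'.of_subset fun w hw => (ZFSet.mem_sdiff.1 hw).1)
  obtain ⟨a, ha, h⟩ := hN.exists_mem
    (R := fun v : Fin 4 → HC.{u} => ∀ w : HC.{u}, w.1 ∈ (v 3).1 ↔
      w.1 = (v 0).1 ∨ (w.1 ∈ (v 1).1 ∧ ¬ w.1 = (v 2).1))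
    (.all (.iff (.mem _ _) (.or (.eq _ _) (.and (.mem _ _) (.not (.eq _ _))))))
    ![⟨x, hx'⟩, ⟨y, hy'⟩, ⟨z, hz'⟩] (by simp [Fin.forall_fin_succ, hx, hy, hz])
    ⟨⟨_, hc⟩, fun w => by
      change w.1 ∈ insert x (y \ {z}) ↔ w.1 = x ∨ (w.1 ∈ y ∧ ¬ w.1 = z)
      simp⟩
  replace h : ∀ w : HC.{u}, w.1 ∈ a.1 ↔ w.1 = x ∨ (w.1 ∈ y ∧ ¬ w.1 = z) := h
  suffices insert x (y \ {z}) = a.1 by rwa [this]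
  ext w
  constructor
  · intro hw
    exact (h ⟨w, hc.mem hw⟩).2 (by simpa using hw)
  · intro hw
    simpa using (h ⟨w, a.2.mem hw⟩).1 hw

/-- An intersection of two transitive sets is transitive, so `delta N` is an ordinal at most `ω₁`;
it is not `ω₁` because `N` is countable. -/
theorem delta_mem_omegaOne (hN : IsModel lt N) : delta N ∈ omegaOne := by
  have ho : omegaOne.{u}.IsOrdinal := ZFSet.isOrdinal_toZFSet _
  have hd : (delta N).IsOrdinal :=
    ZFSet.isOrdinal_iff_forall_mem_isOrdinal.2 ⟨hN.isTransitive.inter ho.isTransitive,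
      fun y hy => ho.mem (ZFSet.mem_inter.1 hy).2⟩
  rcases hd.eq_or_mem_of_subset ho (fun y hy => (ZFSet.mem_inter.1 hy).2) with h | h
  · refine absurd (hN.1.mono fun y hy => ?_) omegaOne_not_countable
    rw [Set.mem_ofPred_eq, ← h] at hy
    exact (ZFSet.mem_inter.1 hy).1
  · exact h

end IsModel

theorem mem_delta_iff {β N : ZFSet.{u}} (hβ : β ∈ omegaOne) : β ∈ delta N ↔ β ∈ N := by
  rw [delta, ZFSet.mem_inter, and_iff_left hβ]

instance : Infinite HC.{u} :=
  Infinite.of_injective (fun n : ℕ => (⟨numeral n, isHC_numeral n⟩ : HC.{u})) fun _ _ h =>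
    numeral_injective (congrArg Subtype.val h)

/-- Downward Löwenheim–Skolem for a countable language. -/
theorem exists_isModel (lt : HC.{u} → HC.{u} → Prop) {A : Set ZFSet.{u}} (hA : A.Countable)
    (h : ∀ x ∈ A, IsHC x) : ∃ N, IsModel lt N ∧ ∀ x ∈ A, x ∈ N := by
  let := hcStructure lt
  have hc : {x : HC.{u} | x.1 ∈ A}.Countable := hA.preimage Subtype.val_injective
  have hF : IsEmpty (Σ n, modelLang.Functions n) := ⟨fun f => Empty.elim f.2⟩
  have hR : Countable (Σ n, modelLang.Relations n) := by
    let e : (Σ n, ModelRel n) → Bool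
      | ⟨_, .mem⟩ => true
      | ⟨_, .lt⟩ => false
    have he : Function.Injective e := by
      rintro ⟨_, _ | _⟩ ⟨_, _ | _⟩ h <;> simp_all [e]
    exact he.countable
  have hL : modelLang.card ≤ Cardinal.aleph0 := by
    rw [Language.card, Cardinal.mk_le_aleph0_iff, Language.Symbols]
    infer_instance
  obtain ⟨S, hAS, hS⟩ := exists_elementarySubstructure_card_eq modelLang {x : HC.{u} | x.1 ∈ A}
    Cardinal.aleph0.{0} le_rfl (by simpa using hc) (by simpa using hL) (by simp)
  have hSc : Set.Countable (S : Set HC.{u}) := by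
    rw [← Cardinal.le_aleph0_iff_set_countable]
    simpa using hS.le
  have : Countable S := hSc
  -- `HC` lives one universe up; countability is what allows the substructure to be collected into a
  -- `ZFSet.{u}`.
  have : Small.{u} S := Countable.toSmall _
  have hmem : ∀ x : ZFSet.{u}, x ∈ ZFSet.range (fun y : S => y.1.1) ↔
      ∃ h : IsHC x, (⟨x, h⟩ : HC.{u}) ∈ S := by
    intro x
    rw [ZFSet.mem_range]
    constructor
    · rintro ⟨y, rfl⟩
      exact ⟨y.1.2, y.2⟩
    · rintro ⟨h, hx⟩
      exact ⟨⟨_, hx⟩, rfl⟩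
  refine ⟨ZFSet.range fun y : S => y.1.1, ⟨?_, S, hmem⟩, fun x hx => ?_⟩
  · refine (Set.countable_range fun y : S => y.1.1).mono fun x hx => ?_
    exact ZFSet.mem_range.1 hx
  · exact (hmem x).2 ⟨h x hx, hAS hx⟩

/-- `⟨s ξ : ξ ≤ γ⟩` is a continuous `∈`-increasing enumeration of `M` by elements of `𝒮`, and the
values of `f` satisfy the finiteness conditions in the definition of `ℙ[α]`. -/
structure IsModelChain (lt : HC.{u} → HC.{u} → Prop) (M f : ZFSet.{u}) (γ : Ordinal.{u})
    (s : Ordinal.{u} → ZFSet.{u}) : Prop where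
  isModel : ∀ ξ ≤ γ, IsModel lt (s ξ)
  mem : ∀ ξ η, ξ < η → η ≤ γ → s ξ ∈ s η
  limit : ∀ η ≤ γ, Order.IsSuccLimit η → ∀ x, x ∈ s η ↔ ∃ ξ < η, x ∈ s ξ
  mem_iff : ∀ N, N ∈ M ↔ ∃ ξ ≤ γ, N = s ξ
  finite_succ : ∀ ξ < γ, ∀ a, ZFSet.pair (s ξ) a ∈ f → {x | x ∈ a}.Finite ∧ a ⊆ s (ξ + 1)
  finite_top : ∀ a, ZFSet.pair (s γ) a ∈ f → {x | x ∈ a}.Finite ∧ ∀ x ∈ a, IsHC x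

/-! ### Extending and modifying set-coded functions -/

section Functions

variable {f M K a : ZFSet.{u}}

theorem IsFunOn.mem_of_pair_mem (hf : IsFunOn f M) (h : ZFSet.pair K a ∈ f) : K ∈ M := by
  obtain ⟨N, hN, b, e⟩ := hf.1 _ h
  rwa [(ZFSet.pair_inj.1 e).1]

theorem IsFunOn.insert {N : ZFSet.{u}} (hf : IsFunOn f M) (hN : N ∉ M) (b : ZFSet.{u}) :
    IsFunOn (insert (ZFSet.pair N b) f) (insert N M) := by
  refine ⟨fun z hz => ?_, fun L hL => ?_⟩
  · rcases ZFSet.mem_insert_iff.1 hz with rfl | hz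
    · exact ⟨N, ZFSet.mem_insert _ _, b, rfl⟩
    · obtain ⟨L, hL, c, e⟩ := hf.1 z hz
      exact ⟨L, ZFSet.mem_insert_of_mem _ hL, c, e⟩
  · rcases ZFSet.mem_insert_iff.1 hL with rfl | hL
    · refine ⟨b, ZFSet.mem_insert _ _, fun c hc => ?_⟩
      rcases ZFSet.mem_insert_iff.1 hc with e | hc
      · exact (ZFSet.pair_inj.1 e).2
      · exact absurd (hf.mem_of_pair_mem hc) hN
    · obtain ⟨c, hc, huniq⟩ := hf.2 L hL
      refine ⟨c, ZFSet.mem_insert_of_mem _ hc, fun d hd => ?_⟩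
      rcases ZFSet.mem_insert_iff.1 hd with e | hd
      · exact absurd ((ZFSet.pair_inj.1 e).1 ▸ hL) hN
      · exact huniq d hd

/-- The function `f` with its value `a` at `K` replaced by `b`. -/
def updateValue (f K a b : ZFSet.{u}) : ZFSet.{u} :=
  insert (ZFSet.pair K b) (f \ {ZFSet.pair K a})

theorem pair_mem_updateValue_iff (hf : IsFunOn f M) (ha : ZFSet.pair K a ∈ f)
    {b L c : ZFSet.{u}} : ZFSet.pair L c ∈ updateValue f K a b ↔
      (L = K ∧ c = b) ∨ (L ≠ K ∧ ZFSet.pair L c ∈ f) := by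
  rw [updateValue, ZFSet.mem_insert_iff, ZFSet.mem_sdiff, ZFSet.mem_singleton, ZFSet.pair_inj,
    ZFSet.pair_inj]
  refine or_congr_right ⟨fun h => ⟨?_, h.1⟩, fun h => ⟨h.2, fun e => h.1 e.1⟩⟩
  rintro rfl
  exact h.2 ⟨rfl, (hf.2 L (hf.mem_of_pair_mem ha)).unique h.1 ha⟩

theorem IsFunOn.updateValue (hf : IsFunOn f M) (ha : ZFSet.pair K a ∈ f) (b : ZFSet.{u}) :
    IsFunOn (updateValue f K a b) M := by
  have hK := hf.mem_of_pair_mem ha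
  refine ⟨fun z hz => ?_, fun L hL => ?_⟩
  · rcases ZFSet.mem_insert_iff.1 hz with rfl | hz
    · exact ⟨K, hK, b, rfl⟩
    · exact hf.1 z (ZFSet.mem_sdiff.1 hz).1
  · simp only [pair_mem_updateValue_iff hf ha]
    by_cases h : L = K
    · exact ⟨b, Or.inl ⟨h, rfl⟩, by simp [h]⟩
    · obtain ⟨c, hc, huniq⟩ := hf.2 L hL
      refine ⟨c, Or.inr ⟨h, hc⟩, fun d hd => ?_⟩
      exact huniq d (by simpa [h] using hd)

theorem funLE_insert {N b : ZFSet.{u}} (hf : IsFunOn f M) (hN : N ∉ M) :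
    FunLE M f (insert (ZFSet.pair N b) f) := by
  intro L hL c d hc hd
  rcases ZFSet.mem_insert_iff.1 hd with e | hd
  · exact absurd ((ZFSet.pair_inj.1 e).1 ▸ hL) hN
  · rw [(hf.2 L hL).unique hc hd]

theorem funLE_updateValue {b : ZFSet.{u}} (hf : IsFunOn f M) (ha : ZFSet.pair K a ∈ f)
    (hab : a ⊆ b) : FunLE M f (updateValue f K a b) := by
  intro L hL c d hc hd
  rcases (pair_mem_updateValue_iff hf ha).1 hd with ⟨rfl, rfl⟩ | ⟨-, hd⟩
  · rwa [(hf.2 L hL).unique hc ha]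
  · rw [(hf.2 L hL).unique hc hd]

end Functions

/-! ### Effect on the restrictions `p↾N` -/

section Restriction

variable {lt : HC.{u} → HC.{u} → Prop} {N : ZFSet.{u}}

theorem IsModel.of_pair_mem (hN : IsModel lt N) {x y : ZFSet.{u}} (h : ZFSet.pair x y ∈ N) :
    x ∈ N ∧ y ∈ N := by
  have h' : ({x, y} : ZFSet.{u}) ∈ N := hN.isTransitive.mem_trans (by simp [ZFSet.pair]) h
  exact ⟨hN.isTransitive.mem_trans (by simp) h', hN.isTransitive.mem_trans (by simp) h'⟩

theorem IsModel.insert_mem (hN : IsModel lt N) {x y : ZFSet.{u}} (hx : x ∈ N) (hy : y ∈ N) :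
    insert x y ∈ N := by
  have : insert x y = insert x (y \ {x}) := by
    ext z
    by_cases h : z = x <;> simp [h]
  rw [this]
  exact hN.insert_diff_singleton_mem hx hy hx

theorem restrictCode_insert {M f W b L : ZFSet.{u}} (h : L ∉ N) :
    restrictCode (insert L M) (insert (ZFSet.pair L b) f) W N = restrictCode M f W N := by
  have h₁ : insert L M ∩ N = M ∩ N := by
    ext z
    rw [ZFSet.mem_inter, ZFSet.mem_inter, ZFSet.mem_insert_iff]
    refine and_congr_left fun hz => or_iff_right ?_
    rintro rfl
    exact h hz
  rw [restrictCode, restrictCode, h₁]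
  congr 2
  ext z
  rw [ZFSet.mem_sep, ZFSet.mem_sep, ZFSet.mem_insert_iff]
  refine and_congr_left fun hz => or_iff_right ?_
  rintro rfl
  obtain ⟨K, hK, a, e⟩ := hz
  rw [(ZFSet.pair_inj.1 e).1] at h
  exact h (ZFSet.mem_inter.1 hK).2

/-- If `K ∉ N`, the restriction does not see the changed value. If `K ∈ N`, then the old pair, `β`
and hence the new pair are in `N`, and exchanging one for the other stays in `N`. -/
theorem restrictCode_updateValue_mem {M f W K a β : ZFSet.{u}} (hN : IsModel lt N)
    (hf : IsFunOn f M) (ha : ZFSet.pair K a ∈ f) (hβ : K ∈ N → β ∈ N)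
    (h : restrictCode M f W N ∈ N) :
    restrictCode M (updateValue f K a (insert β a)) W N ∈ N := by
  have hK := hf.mem_of_pair_mem ha
  obtain ⟨h₁, h₂⟩ := hN.of_pair_mem h
  obtain ⟨h₂, h₃⟩ := hN.of_pair_mem h₂
  refine hN.pair_mem h₁ (hN.pair_mem ?_ h₃)
  by_cases hKN : K ∈ N
  · have hKa : ZFSet.pair K a ∈ N := by
      refine hN.isTransitive.mem_trans ?_ h₂
      exact ZFSet.mem_sep.2 ⟨ha, K, ZFSet.mem_inter.2 ⟨hK, hKN⟩, a, rfl⟩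
    have key := hN.insert_diff_singleton_mem
      (hN.pair_mem hKN (hN.insert_mem (hβ hKN) (hN.of_pair_mem hKa).2)) h₂ hKa
    convert key using 1
    ext z
    simp only [updateValue, ZFSet.mem_sep, ZFSet.mem_insert_iff, ZFSet.mem_sdiff]
    constructor
    · rintro ⟨rfl | h, hz⟩
      · exact Or.inl rfl
      · exact Or.inr ⟨⟨h.1, hz⟩, h.2⟩
    · rintro (rfl | h)
      · exact ⟨Or.inl rfl, K, ZFSet.mem_inter.2 ⟨hK, hKN⟩, _, rfl⟩
      · exact ⟨Or.inr ⟨h.1.1, h.2⟩, h.1.2⟩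
  · convert h₂ using 1
    ext z
    simp only [ZFSet.mem_sep]
    refine and_congr_left ?_
    rintro ⟨L, hL, c, rfl⟩
    have hLK : L ≠ K := by
      rintro rfl
      exact hKN (ZFSet.mem_inter.1 hL).2
    rw [pair_mem_updateValue_iff hf ha]
    simp [hLK]

end Restriction

/-! ### Chains of models: the gap below `β` and adding a top model -/

namespace IsModelChain

variable {lt : HC.{u} → HC.{u} → Prop} {M f : ZFSet.{u}} {γ : Ordinal.{u}}
  {s : Ordinal.{u} → ZFSet.{u}}

theorem isModel_of_mem (h : IsModelChain lt M f γ s) {N : ZFSet.{u}} (hN : N ∈ M) :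
    IsModel lt N := by
  obtain ⟨ξ, hξ, rfl⟩ := (h.mem_iff N).1 hN
  exact h.isModel ξ hξ

theorem mono (h : IsModelChain lt M f γ s) {ξ η : Ordinal.{u}} (hξ : ξ ≤ η) (hη : η ≤ γ) :
    s ξ ⊆ s η := by
  rcases hξ.eq_or_lt with rfl | hlt
  · exact fun _ hx => hx
  · exact (h.isModel η hη).isTransitive.subset_of_mem (h.mem ξ η hlt hη)

theorem lt_of_mem (h : IsModelChain lt M f γ s) {ξ η : Ordinal.{u}} (hξ : ξ ≤ γ)
    (hmem : s ξ ∈ s η) : ξ < η := by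
  by_contra! hle
  exact ZFSet.mem_irrefl _ (h.mono hle hξ hmem)

/-- The promise at work: if `δ_K < δ_N`, then `N` comes after `K` in the chain, so it includes the
successor of `K`, which contains `β` because `β ∈ f(K)`. Then `β < δ_N`. -/
theorem notMem_delta_of_delta_mem (h : IsModelChain lt M f γ s) {K a N β : ZFSet.{u}}
    (hK : K ∈ M) (ha : ZFSet.pair K a ∈ f) (hβa : β ∈ a) (hN : N ∈ M) (hNβ : delta N ∈ β)
    (hβ : β ∈ omegaOne) : delta K ∉ delta N := by
  intro hKN
  obtain ⟨ξ, hξ, rfl⟩ := (h.mem_iff K).1 hK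
  obtain ⟨η, hη, rfl⟩ := (h.mem_iff N).1 hN
  have hlt : ξ < η := by
    by_contra! hle
    have hsub := h.mono hle hξ
    have := ZFSet.mem_inter.1 hKN
    exact ZFSet.mem_irrefl _ (ZFSet.mem_inter.2 ⟨hsub this.1, this.2⟩ : delta (s ξ) ∈ delta (s ξ))
  have hβN : β ∈ delta (s η) := (mem_delta_iff hβ).2
    (h.mono (Order.add_one_le_of_lt hlt) hη
      ((h.finite_succ ξ (hlt.trans_le hη) a ha).2 hβa))
  exact ZFSet.mem_asymm hNβ hβN

/-- Consider the least index whose model contains `β`. It is not `0`, since `h₁` gives a model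
without `β`, and not a limit, by continuity. At its predecessor, `δ` is neither above nor equal to
`β`. -/
theorem exists_gap (h : IsModelChain lt M f γ s) {β : ZFSet.{u}} (hβ : β ∈ omegaOne)
    (h₁ : ∃ N ∈ M, delta N ∈ β) (h₂ : ∃ N ∈ M, β ∈ delta N) (hne : ∀ N ∈ M, delta N ≠ β) :
    ∃ ξ < γ, delta (s ξ) ∈ β ∧ β ∈ s (ξ + 1) := by
  have hex : ∃ η, η ≤ γ ∧ β ∈ s η := by
    obtain ⟨N, hN, hβN⟩ := h₂
    obtain ⟨η, hη, rfl⟩ := (h.mem_iff N).1 hN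
    exact ⟨η, hη, (mem_delta_iff hβ).1 hβN⟩
  obtain ⟨η, ⟨hη, hβη⟩, hmin⟩ := WellFounded.has_min (wellFounded_lt (α := Ordinal.{u}))
    {η | η ≤ γ ∧ β ∈ s η} hex
  have hmin' : ∀ ξ < η, β ∉ s ξ := fun ξ hξ hβξ => hmin ξ ⟨hξ.le.trans hη, hβξ⟩ hξ
  rcases Ordinal.zero_or_succ_or_isSuccLimit η with rfl | ⟨ξ, rfl⟩ | hlim
  · obtain ⟨N, hN, hNβ⟩ := h₁
    obtain ⟨ν, hν, rfl⟩ := (h.mem_iff N).1 hN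
    exact absurd ((mem_delta_iff hβ).2 (h.mono zero_le hν hβη)) (ZFSet.mem_asymm hNβ)
  · have hlt : ξ < ξ + 1 := Order.lt_add_one_iff.2 le_rfl
    have hξ : ξ < γ := hlt.trans_le hη
    refine ⟨ξ, hξ, ?_, hβη⟩
    have hm := (h.isModel ξ hξ.le).delta_mem_omegaOne
    rcases (isOrdinal_of_mem_omegaOne hm).mem_trichotomous (isOrdinal_of_mem_omegaOne hβ) with
      hlt' | heq | hgt
    · exact hlt'
    · exact absurd heq (hne _ ((h.mem_iff _).2 ⟨ξ, hξ.le, rfl⟩))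
    · exact absurd ((mem_delta_iff hβ).1 hgt) (hmin' ξ hlt)
  · obtain ⟨ξ, hξ, hβξ⟩ := (h.limit η hη hlim β).1 hβη
    exact absurd hβξ (hmin' ξ hξ)

theorem updateValue (h : IsModelChain lt M f γ s) (hf : IsFunOn f M) {ξ : Ordinal.{u}}
    (hξ : ξ < γ) {a β : ZFSet.{u}} (ha : ZFSet.pair (s ξ) a ∈ f) (hβ : β ∈ s (ξ + 1)) :
    IsModelChain lt M (updateValue f (s ξ) a (insert β a)) γ s where
  isModel := h.isModel
  mem := h.mem
  limit := h.limit
  mem_iff := h.mem_iff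
  finite_succ η hη c hc := by
    rcases (pair_mem_updateValue_iff hf ha).1 hc with ⟨e, rfl⟩ | ⟨-, hc⟩
    · obtain rfl : η = ξ := by
        rcases lt_trichotomy η ξ with hlt | heq | hgt
        · exact absurd (e ▸ h.mem η ξ hlt hξ.le) (ZFSet.mem_irrefl _)
        · exact heq
        · exact absurd (e ▸ h.mem ξ η hgt hη.le) (ZFSet.mem_irrefl _)
      obtain ⟨hfin, hsub⟩ := h.finite_succ η hη a ha
      refine ⟨(hfin.insert β).subset fun x hx => ?_, fun x hx => ?_⟩
      · exact ZFSet.mem_insert_iff.1 hx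
      · rcases ZFSet.mem_insert_iff.1 hx with rfl | hx
        exacts [hβ, hsub hx]
    · exact h.finite_succ η hη c hc
  finite_top c hc := by
    rcases (pair_mem_updateValue_iff hf ha).1 hc with ⟨e, rfl⟩ | ⟨-, hc⟩
    · exact absurd (e ▸ h.mem ξ γ hξ le_rfl) (ZFSet.mem_irrefl _)
    · exact h.finite_top c hc

/-- Extends the chain by one step, with the empty set as the value at the new top. -/
theorem exists_append (h : IsModelChain lt M f γ s) (hf : IsFunOn f M) {β : ZFSet.{u}}
    (hβ : IsHC β) : ∃ N, IsModel lt N ∧ β ∈ N ∧ (∀ K ∈ M, K ∈ N) ∧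
      ∃ s', IsModelChain lt (insert N M) (insert (ZFSet.pair N ∅) f) (γ + 1) s' := by
  obtain ⟨a, ha, -⟩ := hf.2 (s γ) ((h.mem_iff _).2 ⟨γ, le_rfl, rfl⟩)
  obtain ⟨hfin, haHC⟩ := h.finite_top a ha
  -- The elements of `a = f(s γ)` are included because `s γ` stops being the top, and its value must
  -- then be a subset of the next model `N`.
  obtain ⟨N, hN, hAN⟩ := exists_isModel lt (A := insert β (insert (s γ) {x | x ∈ a}))
    ((hfin.countable.insert _).insert _) (by
      rintro x (rfl | rfl | hx)
      exacts [hβ, (h.isModel γ le_rfl).isHC, haHC x hx])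
  have hβN : β ∈ N := hAN _ (Or.inl rfl)
  have hsγ : s γ ∈ N := hAN _ (Or.inr (Or.inl rfl))
  have haN : a ⊆ N := fun x hx => hAN x (Or.inr (Or.inr hx))
  have hsN : ∀ ξ ≤ γ, s ξ ∈ N := by
    intro ξ hξ
    rcases hξ.eq_or_lt with rfl | hlt
    · exact hsγ
    · exact hN.isTransitive.mem_trans (h.mem ξ γ hlt le_rfl) hsγ
  have hlt : γ < γ + 1 := Order.lt_add_one_iff.2 le_rfl
  have hs₁ : ∀ ξ ≤ γ, Function.update s (γ + 1) N ξ = s ξ := fun ξ hξ =>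
    Function.update_of_ne (hξ.trans_lt hlt).ne _ _
  have hs₂ : Function.update s (γ + 1) N (γ + 1) = N := Function.update_self _ _ _
  have hcases : ∀ ξ ≤ γ + 1, ξ ≤ γ ∨ ξ = γ + 1 := fun ξ hξ =>
    hξ.lt_or_eq.imp_left Order.lt_add_one_iff.1
  have hpair : ∀ ξ ≤ γ, ∀ b, ZFSet.pair (s ξ) b ∈ insert (ZFSet.pair N ∅) f →
      ZFSet.pair (s ξ) b ∈ f := by
    intro ξ hξ b hb
    refine (ZFSet.mem_insert_iff.1 hb).resolve_left fun e => ?_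
    exact ZFSet.mem_irrefl N ((ZFSet.pair_inj.1 e).1 ▸ hsN ξ hξ)
  refine ⟨N, hN, hβN, fun K hK => ?_, Function.update s (γ + 1) N, ?_, ?_, ?_, ?_, ?_, ?_⟩
  · obtain ⟨ξ, hξ, rfl⟩ := (h.mem_iff K).1 hK
    exact hsN ξ hξ
  · intro ξ hξ
    rcases hcases ξ hξ with hξ | rfl
    · rw [hs₁ ξ hξ]
      exact h.isModel ξ hξ
    · rwa [hs₂]
  · intro ξ η hξη hη
    rcases hcases η hη with hη | rfl
    · rw [hs₁ ξ (hξη.le.trans hη), hs₁ η hη]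
      exact h.mem ξ η hξη hη
    · rw [hs₁ ξ (Order.lt_add_one_iff.1 hξη), hs₂]
      exact hsN ξ (Order.lt_add_one_iff.1 hξη)
  · intro η hη hlim x
    rcases hcases η hη with hη | rfl
    · rw [hs₁ η hη, h.limit η hη hlim x]
      refine exists_congr fun ξ => and_congr_right fun hξ => ?_
      rw [hs₁ ξ (hξ.le.trans hη)]
    · exact absurd hlim (Order.not_isSuccLimit_add_one γ)
  · intro L
    rw [ZFSet.mem_insert_iff, h.mem_iff]
    constructor
    · rintro (rfl | ⟨ξ, hξ, rfl⟩)
      · exact ⟨γ + 1, le_rfl, hs₂.symm⟩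
      · exact ⟨ξ, hξ.trans hlt.le, (hs₁ ξ hξ).symm⟩
    · rintro ⟨ξ, hξ, rfl⟩
      rcases hcases ξ hξ with hξ | rfl
      · exact Or.inr ⟨ξ, hξ, hs₁ ξ hξ⟩
      · exact Or.inl hs₂
  · intro ξ hξ b hb
    rw [Order.lt_add_one_iff] at hξ
    rw [hs₁ ξ hξ] at hb
    have hb' := hpair ξ hξ b hb
    rcases hξ.eq_or_lt with rfl | hξ
    · obtain rfl := (hf.2 _ ((h.mem_iff _).2 ⟨ξ, le_rfl, rfl⟩)).unique ha hb'
      rw [hs₂]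
      exact ⟨hfin, haN⟩
    · rw [hs₁ _ (Order.add_one_le_of_lt hξ)]
      exact h.finite_succ ξ hξ b hb'
  · intro b hb
    rw [hs₂] at hb
    have hNM : N ∉ M := by
      intro hNM
      obtain ⟨ξ, hξ, e⟩ := (h.mem_iff N).1 hNM
      exact ZFSet.mem_irrefl N (e ▸ hsN ξ hξ)
    obtain rfl : b = ∅ := (ZFSet.pair_inj.1 ((ZFSet.mem_insert_iff.1 hb).resolve_right
      fun hb => hNM (hf.mem_of_pair_mem hb))).2
    simp

end IsModelChain

variable {lt : HC.{u} → HC.{u} → Prop}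

/-! ### The forcing `ℙ[α]` -/

namespace Cond

variable {α : Ordinal.{u}}

theorem exists_isModelChain (p : Cond lt α) :
    ∃ γ < α, ∃ s, IsModelChain lt p.models p.f γ s := by
  obtain ⟨γ, hγ, s, h₁, h₂, h₃, h₄, h₅, h₆⟩ := p.chain
  exact ⟨γ, hγ, s, h₁, h₂, h₃, h₄, h₅, h₆⟩

theorem delta_mem (p : Cond lt α) {N : ZFSet.{u}} (hN : N ∈ p.models) : delta N ∈ omegaOne := by
  obtain ⟨γ, -, s, h⟩ := p.exists_isModelChain
  exact (h.isModel_of_mem hN).delta_mem_omegaOne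

theorem exists_le_mem_delta (hα : ∀ γ < α, γ + 1 < α) (p : Cond lt α) {β : ZFSet.{u}}
    (hβ : β ∈ omegaOne) : ∃ q ≤ p, ∃ N ∈ q.models, β ∈ delta N := by
  obtain ⟨γ, hγ, s, h⟩ := p.exists_isModelChain
  obtain ⟨N, hN, hβN, hMN, s', h'⟩ := h.exists_append p.isFunOn (isHC_of_mem_omegaOne hβ)
  have hNM : N ∉ p.models := fun hNM => ZFSet.mem_irrefl N (hMN N hNM)
  have hsub : p.models ⊆ insert N p.models := fun L hL => ZFSet.mem_insert_of_mem _ hL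
  exact ⟨⟨insert N p.models, insert (ZFSet.pair N ∅) p.f, p.W, p.isFunOn.insert hNM ∅,
    ⟨γ + 1, hα γ hγ, s', h'.isModel, h'.mem, h'.limit, h'.mem_iff, h'.finite_succ, h'.finite_top⟩,
    fun K hK => hsub (p.W_subset hK), fun K hK => by
      -- Every old model belongs to the new one, so the new one belongs to no `K ∈ 𝓦` and leaves
      -- `p↾K` unchanged.
      rw [restrictCode_insert (ZFSet.mem_asymm (hMN K (p.W_subset hK)))]
      exact p.restrict_mem K hK⟩,
    ⟨hsub, funLE_insert p.isFunOn hNM, fun _ hK => hK⟩,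
    N, ZFSet.mem_insert _ _, (mem_delta_iff hβ).2 hβN⟩

theorem exists_le_gap (p : Cond lt α) {β : ZFSet.{u}} (hβ : β ∈ omegaOne)
    (h₁ : ∃ N ∈ p.models, delta N ∈ β) (h₂ : ∃ N ∈ p.models, β ∈ delta N)
    (hne : ∀ N ∈ p.models, delta N ≠ β) :
    ∃ q ≤ p, ∃ x ∈ β, ∀ r ≤ q, ∀ N ∈ r.models, delta N ∈ β → x ∉ delta N := by
  obtain ⟨γ, hγ, s, h⟩ := p.exists_isModelChain
  obtain ⟨ξ, hξ, hξβ, hβξ⟩ := h.exists_gap hβ h₁ h₂ hne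
  have hK : s ξ ∈ p.models := (h.mem_iff _).2 ⟨ξ, hξ.le, rfl⟩
  obtain ⟨a, ha, -⟩ := p.isFunOn.2 _ hK
  have h' := h.updateValue p.isFunOn hξ ha hβξ
  let q : Cond lt α := ⟨p.models, updateValue p.f (s ξ) a (insert β a), p.W,
    p.isFunOn.updateValue ha _,
    ⟨γ, hγ, s, h'.isModel, h'.mem, h'.limit, h'.mem_iff, h'.finite_succ, h'.finite_top⟩,
    p.W_subset, fun N hN => by
      refine restrictCode_updateValue_mem (h.isModel_of_mem (p.W_subset hN)) p.isFunOn ha ?_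
        (p.restrict_mem N hN)
      -- If `s ξ ∈ s η` then `ξ + 1 ≤ η`, hence `β ∈ s (ξ + 1) ⊆ s η`.
      obtain ⟨η, hη, rfl⟩ := (h.mem_iff N).1 (p.W_subset hN)
      exact fun hmem => h.mono (Order.add_one_le_of_lt (h.lt_of_mem hξ.le hmem)) hη hβξ⟩
  refine ⟨q, ⟨fun _ hL => hL, funLE_updateValue p.isFunOn ha
    fun x hx => ZFSet.mem_insert_of_mem _ hx, fun _ hL => hL⟩, delta (s ξ), hξβ,
    fun r hr N hN hNβ => ?_⟩
  obtain ⟨γ', -, s', h''⟩ := r.exists_isModelChain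
  obtain ⟨b, hb, -⟩ := r.isFunOn.2 _ (hr.1 hK)
  have hab := hr.2.1 _ hK _ _ ((pair_mem_updateValue_iff p.isFunOn ha).2 (Or.inl ⟨rfl, rfl⟩)) hb
  exact h''.notMem_delta_of_delta_mem (hr.1 hK) hb (hab (ZFSet.mem_insert _ _)) hN hNβ hβ

theorem forces_club (hα : ∀ γ < α, γ + 1 < α) (p : Cond lt α) :
    Forces clubFormula ![clubName fun q : Cond lt α => q.models,
      Name.check (Cond lt α) omegaOne.{u}] p :=
  ClubForcing.forces_club (fun _ _ h => And.left h) (fun p _ hN => p.delta_mem hN)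
    (fun p _ hβ => p.exists_le_mem_delta hα hβ) (fun p _ hβ => p.exists_le_gap hβ) p

end Cond

/-! ### The forcing `ℙ` with finite conditions -/

namespace FinCond

/-- The finite case of `IsModelChain`, in the form used in the definition of `ℙ`. -/
theorem chain_of_isModelChain {M f : ZFSet.{u}} {γ : Ordinal.{u}} {s : Ordinal.{u} → ZFSet.{u}}
    (hγ : γ < ω) (h : IsModelChain lt M f γ s) :
    ∃ (n : ℕ) (s : ℕ → ZFSet.{u}),
      (∀ i < n, IsModel lt (s i)) ∧
      (∀ i j, i < j → j < n → s i ∈ s j) ∧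
      (∀ N, N ∈ M ↔ ∃ i < n, N = s i) ∧
      (∀ i, i + 1 < n → ∀ a, ZFSet.pair (s i) a ∈ f → {x | x ∈ a}.Finite ∧ a ⊆ s (i + 1)) ∧
      (∀ i, i + 1 = n → ∀ a, ZFSet.pair (s i) a ∈ f →
        {x | x ∈ a}.Finite ∧ ∀ x ∈ a, IsHC x) := by
  obtain ⟨n, rfl⟩ := Ordinal.lt_omega0.1 hγ
  refine ⟨n + 1, fun i => s i, fun i hi => ?_, fun i j hij hj => ?_, fun N => ?_,
    fun i hi a ha => ?_, fun i hi a ha => ?_⟩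
  · exact h.isModel _ (by exact_mod_cast Nat.lt_succ_iff.1 hi)
  · exact h.mem _ _ (by exact_mod_cast hij) (by exact_mod_cast Nat.lt_succ_iff.1 hj)
  · rw [h.mem_iff]
    constructor
    · rintro ⟨ξ, hξ, rfl⟩
      obtain ⟨i, rfl⟩ := Ordinal.lt_omega0.1 (hξ.trans_lt hγ)
      exact ⟨i, Nat.lt_succ_iff.2 (by exact_mod_cast hξ), rfl⟩
    · rintro ⟨i, hi, rfl⟩
      exact ⟨i, by exact_mod_cast Nat.lt_succ_iff.1 hi, rfl⟩
  · have := h.finite_succ i (by exact_mod_cast Nat.lt_of_succ_lt_succ hi) a ha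
    exact_mod_cast this
  · obtain rfl : i = n := Nat.succ_injective hi
    exact h.finite_top a ha

/-- A model `N` is required since a condition of `ℙ` may be empty, whereas an `IsModelChain` always
has a top index. -/
theorem exists_isModelChain (p : FinCond lt) {N : ZFSet.{u}} (hN : N ∈ p.models) :
    ∃ γ < ω, ∃ s, IsModelChain lt p.models p.f γ s := by
  obtain ⟨n, s, h₁, h₂, h₃, h₄, h₅⟩ := p.chain
  obtain ⟨m, rfl⟩ : ∃ m, n = m + 1 := by
    obtain ⟨i, hi, -⟩ := (h₃ N).1 hN
    exact Nat.exists_eq_succ_of_ne_zero (Nat.ne_zero_of_lt hi)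
  have hm : (m : Ordinal.{u}) < ω := Ordinal.natCast_lt_omega0 m
  have hnat : ∀ ξ ≤ (m : Ordinal.{u}), ∃ k ≤ m, ξ = k := by
    intro ξ hξ
    obtain ⟨k, rfl⟩ := Ordinal.lt_omega0.1 (hξ.trans_lt hm)
    exact ⟨k, by exact_mod_cast hξ, rfl⟩
  -- Only the values at finite ordinals `ξ ≤ m` matter, where this is `s` itself.
  let s' : Ordinal.{u} → ZFSet.{u} := fun ξ => s (Cardinal.toNat ξ.card)
  have hs' : ∀ k : ℕ, s' k = s k := fun k => by simp [s']
  refine ⟨m, hm, s', fun ξ hξ => ?_, fun ξ η hlt hη => ?_, fun η hη hlim => ?_, fun L => ?_,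
    fun ξ hξ a ha => ?_, fun a ha => ?_⟩
  · obtain ⟨k, hk, rfl⟩ := hnat ξ hξ
    rw [hs']
    exact h₁ k (Nat.lt_succ_of_le hk)
  · obtain ⟨k, hk, rfl⟩ := hnat η hη
    obtain ⟨l, hl, rfl⟩ := hnat ξ (hlt.le.trans hη)
    rw [hs', hs']
    exact h₂ l k (by exact_mod_cast hlt) (Nat.lt_succ_of_le hk)
  · exact absurd (hη.trans_lt hm) (Ordinal.omega0_le_of_isSuccLimit hlim).not_gt
  · rw [h₃]
    constructor
    · rintro ⟨i, hi, rfl⟩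
      exact ⟨i, by exact_mod_cast Nat.lt_succ_iff.1 hi, (hs' i).symm⟩
    · rintro ⟨ξ, hξ, rfl⟩
      obtain ⟨k, hk, rfl⟩ := hnat ξ hξ
      exact ⟨k, Nat.lt_succ_of_le hk, hs' k⟩
  · obtain ⟨k, -, rfl⟩ := hnat ξ hξ.le
    rw [hs'] at ha
    have := hs' (k + 1)
    push_cast at this
    rw [this]
    exact h₄ k (Nat.succ_lt_succ (by exact_mod_cast hξ)) a ha
  · rw [hs'] at ha
    exact h₅ m rfl a ha

theorem delta_mem (p : FinCond lt) {N : ZFSet.{u}} (hN : N ∈ p.models) : delta N ∈ omegaOne := by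
  obtain ⟨γ, -, s, h⟩ := p.exists_isModelChain hN
  exact (h.isModel_of_mem hN).delta_mem_omegaOne

theorem isModelChain_singleton {N : ZFSet.{u}} (hN : IsModel lt N) :
    IsModelChain lt {N} {ZFSet.pair N ∅} 0 fun _ => N where
  isModel _ _ := hN
  mem ξ η h hη := absurd (h.trans_le hη) (not_lt_bot (a := ξ))
  limit η hη h := absurd (nonpos_iff_eq_zero.1 hη) h.ne_bot
  mem_iff L := by
    rw [ZFSet.mem_singleton]
    exact ⟨fun h => ⟨0, le_rfl, h⟩, fun ⟨_, _, h⟩ => h⟩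
  finite_succ ξ h := absurd h (not_lt_bot (a := ξ))
  finite_top a ha := by
    obtain rfl : a = ∅ := (ZFSet.pair_inj.1 (ZFSet.mem_singleton.1 ha)).2
    simp

theorem exists_le_mem_delta (p : FinCond lt) {β : ZFSet.{u}} (hβ : β ∈ omegaOne) :
    ∃ q ≤ p, ∃ N ∈ q.models, β ∈ delta N := by
  by_cases hne : ∃ K, K ∈ p.models
  · obtain ⟨K, hK⟩ := hne
    obtain ⟨γ, hγ, s, h⟩ := p.exists_isModelChain hK
    obtain ⟨N, hN, hβN, hMN, s', h'⟩ := h.exists_append p.isFunOn (isHC_of_mem_omegaOne hβ)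
    have hNM : N ∉ p.models := fun hNM => ZFSet.mem_irrefl N (hMN N hNM)
    exact ⟨⟨insert N p.models, insert (ZFSet.pair N ∅) p.f, p.isFunOn.insert hNM ∅,
      chain_of_isModelChain (Ordinal.isSuccLimit_omega0.add_one_lt hγ) h'⟩,
      ⟨fun L hL => ZFSet.mem_insert_of_mem _ hL, funLE_insert p.isFunOn hNM⟩,
      N, ZFSet.mem_insert _ _, (mem_delta_iff hβ).2 hβN⟩
  -- The empty condition has no top model to extend; a single model containing `β` is used instead.
  · obtain ⟨N, hN, hβN⟩ := exists_isModel lt (Set.countable_singleton β)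
      (by simpa using isHC_of_mem_omegaOne hβ)
    refine ⟨⟨{N}, {ZFSet.pair N ∅}, ⟨?_, ?_⟩,
      chain_of_isModelChain Ordinal.omega0_pos (isModelChain_singleton hN)⟩,
      ⟨fun L hL => absurd ⟨L, hL⟩ hne, fun L hL => absurd ⟨L, hL⟩ hne⟩,
      N, ZFSet.mem_singleton.2 rfl, (mem_delta_iff hβ).2 (hβN β rfl)⟩
    · exact fun z hz => ⟨N, ZFSet.mem_singleton.2 rfl, ∅, ZFSet.mem_singleton.1 hz⟩
    · intro L hL
      rw [ZFSet.mem_singleton.1 hL]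
      exact ⟨∅, ZFSet.mem_singleton.2 rfl, fun a ha =>
        (ZFSet.pair_inj.1 (ZFSet.mem_singleton.1 ha)).2⟩

theorem exists_le_gap (p : FinCond lt) {β : ZFSet.{u}} (hβ : β ∈ omegaOne)
    (h₁ : ∃ N ∈ p.models, delta N ∈ β) (h₂ : ∃ N ∈ p.models, β ∈ delta N)
    (hne : ∀ N ∈ p.models, delta N ≠ β) :
    ∃ q ≤ p, ∃ x ∈ β, ∀ r ≤ q, ∀ N ∈ r.models, delta N ∈ β → x ∉ delta N := by
  obtain ⟨L, hL, -⟩ := id h₁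
  obtain ⟨γ, hγ, s, h⟩ := p.exists_isModelChain hL
  obtain ⟨ξ, hξ, hξβ, hβξ⟩ := h.exists_gap hβ h₁ h₂ hne
  have hK : s ξ ∈ p.models := (h.mem_iff _).2 ⟨ξ, hξ.le, rfl⟩
  obtain ⟨a, ha, -⟩ := p.isFunOn.2 _ hK
  let q : FinCond lt := ⟨p.models, updateValue p.f (s ξ) a (insert β a),
    p.isFunOn.updateValue ha _, chain_of_isModelChain hγ (h.updateValue p.isFunOn hξ ha hβξ)⟩
  refine ⟨q, ⟨fun _ hL => hL, funLE_updateValue p.isFunOn ha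
    fun x hx => ZFSet.mem_insert_of_mem _ hx⟩, delta (s ξ), hξβ, fun r hr N hN hNβ => ?_⟩
  obtain ⟨γ', -, s', h'⟩ := r.exists_isModelChain hN
  obtain ⟨b, hb, -⟩ := r.isFunOn.2 _ (hr.1 hK)
  have hab := hr.2 _ hK _ _ ((pair_mem_updateValue_iff p.isFunOn ha).2 (Or.inl ⟨rfl, rfl⟩)) hb
  exact h'.notMem_delta_of_delta_mem (hr.1 hK) hb (hab (ZFSet.mem_insert _ _)) hN hNβ hβ

theorem forces_club (p : FinCond lt) :
    Forces clubFormula ![clubName fun q : FinCond lt => q.models,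
      Name.check (FinCond lt) omegaOne.{u}] p :=
  ClubForcing.forces_club (fun _ _ h => And.left h) (fun p _ hN => p.delta_mem hN)
    (fun p _ hβ => p.exists_le_mem_delta hβ) (fun p _ hβ => p.exists_le_gap hβ) p

end FinCond

end ClubForcing

theorem mainTheorem4
    (lt : ClubForcing.HC.{u} → ClubForcing.HC.{u} → Prop)
    [IsWellOrder ClubForcing.HC.{u} lt] :
    (∀ α : Ordinal.{u}, α < ω_ 1 → 1 < α → Ordinal.IsPrincipal (· + ·) α →
      ∀ p : ClubForcing.Cond lt α,
        ClubForcing.Forces ClubForcing.clubFormula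
          ![ClubForcing.clubName (fun q : ClubForcing.Cond lt α => q.models),
            ClubForcing.Name.check (ClubForcing.Cond lt α) ClubForcing.omegaOne.{u}] p) ∧
    (∀ p : ClubForcing.FinCond lt,
        ClubForcing.Forces ClubForcing.clubFormula
          ![ClubForcing.clubName (fun q : ClubForcing.FinCond lt => q.models),
            ClubForcing.Name.check (ClubForcing.FinCond lt) ClubForcing.omegaOne.{u}] p) :=
  -- Indecomposability applied to `γ < α` and `1 < α` gives `γ + 1 < α`, the room for one more
  -- model.
  ⟨fun _ _ h₁ hα p => p.forces_club fun _ hγ => hα hγ h₁, fun p => p.forces_club⟩
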